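/- Let $K\subset\mathbb{C}$ be $\mathbb{Q}$ or an imaginary quadratic number field, with ring of integers $\mathbb{Z}_K$, and let $m,s\ge 1$ be integers. Let $q=a/b$ with $a,b\in\mathbb{Z}_K$ and $|q|>1$. Let $P(z)\in K[z]$ be a polynomial with $\deg P\le s$, $P(0)\neq 0$ and $P(q^{-k})\ne 0$ for all $k=0,1,2,\dots$, and let $$\varphi(z)=1+\sum_{n=1}^{\infty}\frac{q^{-sn(n-1)/2}}{P(1)P(q^{-1})\cdots P(q^{-(n-1)})}\,z^n$$ be the generalized Heine series. For $0\le\gamma<1$ put $$\rho_0=\rho_0(m,s,\gamma)=\frac{13m}{4}+\frac{\gamma}{2(1-\gamma)}+\sqrt{\left(\frac{13m}{4}+\frac{\gamma}{2(1-\gamma)}\right)^2+\frac{13m(s+2)+s+17}{4s}+\frac{(s+2)\gamma}{2s(1-\gamma)}},$$ $$\mu(m,s,\gamma)=\frac{4s\rho_0^2+4(s+2)\rho_0+(s+17)}{4\rho_0-13m-\gamma\left(4ms\rho_0^2+4(ms+2m+1)\rho_0+ms+4m+2\right)},$$ $$f(\gamma)=\frac{4\rho_0-13m}{4sm\rho_0^2+4(2m+ms+1)\rho_0+4m+ms+2}-\gamma,$$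 and let $\Gamma(m,s)=\min\{\tau : f(\tau)=0,\ 0<\tau<1\}$ (this minimum exists). Suppose that $$\gamma:=\frac{\log|b|}{\log|a|}<\Gamma(m,s).$$ Let $\alpha_1,\dots,\alpha_m$ be non-zero elements of $K$ with $\alpha_i\neq\alpha_jq^{l}$ for all $i\ne j$ and all $l\in\mathbb{Z}$, and suppose that either $\deg P<s$, or $\deg P=s$ and $\alpha_i\ne P_sq^n$ for all $i=1,\dots,m$ and all integers $n\ge 1$, where $P_s$ is the leading coefficient of $P$. Then for every $\varepsilon>0$ there is a constant $C=C(\varepsilon)>0$ such that for all $(l_0,l_1,\dots,l_m)\in\mathbb{Z}_K^{m+1}\setminus\{0\}$ $$|l_0+l_1\varphi(\alpha_1)+\cdots+l_m\varphi(\alpha_m)|>C\,H^{-\mu(m,s,\gamma)-\varepsilon},\qquad H=\prod_{i=1}^m\max\{1,|l_i|\}.$$ -/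

import Mathlib

open Polynomial

namespace Heine

/-- `K` is the field of rational numbers (degree one over `ℚ`) or an imaginary quadratic field. -/
def IsRatOrImagQuadratic (K : Type*) [Field K] [NumberField K] : Prop :=
  Module.finrank ℚ K = 1 ∨ (Module.finrank ℚ K = 2 ∧ NumberField.IsTotallyComplex K)

/-- The `n`-th term `q^{-s n(n-1)/2} / (P(1) P(q⁻¹) ⋯ P(q^{-(n-1)})) * z^n` of the generalized
Heine series. The division `n * (n - 1) / 2` of natural numbers is exact, and the term is `1`
for `n = 0`. -/
noncomputable def term (s : ℕ) (P : ℂ[X]) (q z : ℂ) (n : ℕ) : ℂ :=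
  (q ^ (s * (n * (n - 1) / 2)))⁻¹ / (∏ k ∈ Finset.range n, P.eval ((q ^ k)⁻¹)) * z ^ n

/-- The generalized Heine series `φ(z)`. -/
noncomputable def phi (s : ℕ) (P : ℂ[X]) (q z : ℂ) : ℂ :=
  1 + ∑' n : ℕ, term s P q z (n + 1)

theorem term_succ (s : ℕ) (P : ℂ[X]) (q z : ℂ) (n : ℕ) :
    term s P q z (n + 1) =
      term s P q z n * (((q⁻¹) ^ n) ^ s * (P.eval ((q⁻¹) ^ n))⁻¹ * z) := by
  have h : (n + 1) * (n + 1 - 1) / 2 = n * (n - 1) / 2 + n := by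
    have h1 := Nat.triangle_succ n
    simpa using h1
  unfold term
  rw [h, Finset.prod_range_succ, mul_add, pow_add, pow_succ z n, mul_inv, div_eq_mul_inv,
    div_eq_mul_inv, mul_inv, ← inv_pow q n, mul_comm s n, pow_mul q n s, inv_pow q n,
    inv_pow (q ^ n) s]
  ring

/-- The series converges at every point, so that the infinite sum in `phi` is a genuine one. -/
theorem summable_term {s : ℕ} (hs : 1 ≤ s) {P : ℂ[X]} {q : ℂ} (hq : 1 < ‖q‖)
    (hP0 : P.eval 0 ≠ 0) (hP : ∀ k : ℕ, P.eval ((q ^ k)⁻¹) ≠ 0) (z : ℂ) :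
    Summable (fun n : ℕ => term s P q z (n + 1)) := by
  rw [summable_nat_add_iff (f := fun n : ℕ => term s P q z n) 1]
  rcases eq_or_ne z 0 with rfl | hz
  · refine summable_of_ne_finset_zero (s := {0}) fun n hn => ?_
    have : n ≠ 0 := by simpa using hn
    simp [term, this]
  have hq0 : q ≠ 0 := by
    rintro rfl
    simp at hq
    linarith
  have hne : ∀ n, term s P q z n ≠ 0 := fun n => by
    unfold term
    refine mul_ne_zero (div_ne_zero (inv_ne_zero (pow_ne_zero _ hq0)) ?_) (pow_ne_zero _ hz)
    exact Finset.prod_ne_zero_iff.2 fun k _ => hP k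
  have hlim : Filter.Tendsto (fun n : ℕ => (q⁻¹) ^ n) Filter.atTop (nhds 0) := by
    apply tendsto_pow_atTop_nhds_zero_of_norm_lt_one
    rw [norm_inv]
    exact inv_lt_one_of_one_lt₀ hq
  have h1 : Filter.Tendsto (fun n : ℕ => ((q⁻¹) ^ n) ^ s * (P.eval ((q⁻¹) ^ n))⁻¹ * z)
      Filter.atTop (nhds (0 ^ s * (P.eval 0)⁻¹ * z)) :=
    ((hlim.pow s).mul (((P.continuous.tendsto 0).comp hlim).inv₀ hP0)).mul_const z
  have h2 := h1.norm
  rw [zero_pow (by omega), zero_mul, zero_mul, norm_zero] at h2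
  refine summable_of_ratio_test_tendsto_lt_one (l := 0) one_pos
    (Filter.Eventually.of_forall hne) (h2.congr fun n => ?_)
  rw [term_succ, norm_mul (term s P q z n), mul_div_cancel_left₀ _ (norm_ne_zero_iff.2 (hne n))]

/-- The quantity `ρ₀(m, s, γ)`. -/
noncomputable def rho (m s : ℕ) (γ : ℝ) : ℝ :=
  13 * m / 4 + γ / (2 * (1 - γ)) +
    √((13 * m / 4 + γ / (2 * (1 - γ))) ^ 2 + (13 * m * (s + 2) + s + 17) / (4 * s)
      + (s + 2) * γ / (2 * s * (1 - γ)))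

/-- The exponent `μ(m, s, γ)`. -/
noncomputable def mu (m s : ℕ) (γ : ℝ) : ℝ :=
  (4 * s * rho m s γ ^ 2 + 4 * (s + 2) * rho m s γ + (s + 17)) /
    (4 * rho m s γ - 13 * m -
      γ * (4 * m * s * rho m s γ ^ 2 + 4 * (m * s + 2 * m + 1) * rho m s γ
        + m * s + 4 * m + 2))

/-- The function `f` whose smallest zero in `(0, 1)` bounds the admissible `γ`. -/
noncomputable def aux (m s : ℕ) (γ : ℝ) : ℝ :=
  (4 * rho m s γ - 13 * m) /
    (4 * s * m * rho m s γ ^ 2 + 4 * (2 * m + m * s + 1) * rho m s γ + 4 * m + m * s + 2) - γ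

/-- `Γ(m, s)`: the smallest zero of `f` in `(0, 1)`; it exists by `isLeast_Gamma`. -/
noncomputable def Gamma (m s : ℕ) : ℝ :=
  sInf {τ : ℝ | aux m s τ = 0 ∧ 0 < τ ∧ τ < 1}

/-- For `m, s ≥ 1` the minimum defining `Γ(m, s)` exists. -/
theorem isLeast_Gamma {m s : ℕ} (hm : 1 ≤ m) (hs : 1 ≤ s) :
    IsLeast {τ : ℝ | aux m s τ = 0 ∧ 0 < τ ∧ τ < 1} (Gamma m s) := by
  have hm' : (1 : ℝ) ≤ m := by exact_mod_cast hm
  have hs' : (1 : ℝ) ≤ s := by exact_mod_cast hs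
  have hrho : ∀ τ : ℝ, 0 ≤ τ → τ ≤ 1 / 2 → 13 * (m : ℝ) / 4 < rho m s τ := by
    intro τ h0 h1
    have h2 : 0 < 1 - τ := by linarith
    have h3 : 0 ≤ τ / (2 * (1 - τ)) := by positivity
    have h4 : 0 < √((13 * (m : ℝ) / 4 + τ / (2 * (1 - τ))) ^ 2
        + (13 * m * (s + 2) + s + 17) / (4 * s) + (s + 2) * τ / (2 * s * (1 - τ))) := by
      apply Real.sqrt_pos.2
      positivity
    unfold rho
    linarith
  have hden : ∀ τ : ℝ, 0 ≤ τ → τ ≤ 1 / 2 →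
      0 < 4 * s * m * rho m s τ ^ 2 + 4 * (2 * m + m * s + 1) * rho m s τ
        + 4 * m + m * s + 2 := by
    intro τ h0 h1
    have h2 := hrho τ h0 h1
    have h3 : 0 < rho m s τ := by linarith
    positivity
  have hf0 : 0 < aux m s 0 := by
    have h1 := hrho 0 le_rfl (by norm_num)
    unfold aux
    rw [sub_zero]
    exact div_pos (by linarith) (hden 0 le_rfl (by norm_num))
  have hf1 : aux m s (1 / 2) < 0 := by
    have h1 := hrho (1 / 2) (by norm_num) le_rfl
    have h2 : 0 < rho m s (1 / 2) := by linarith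
    have h3 := hden (1 / 2) (by norm_num) le_rfl
    unfold aux
    rw [sub_neg, div_lt_iff₀ h3]
    have h4 : 0 ≤ 4 * s * m * rho m s (1 / 2) ^ 2 := by positivity
    have h5 : 0 ≤ ((m : ℝ) * s) * rho m s (1 / 2) := by positivity
    have h6 : 0 ≤ ((m : ℝ) - 1) * rho m s (1 / 2) := mul_nonneg (by linarith) h2.le
    have h7 : 0 ≤ (m : ℝ) * s := by positivity
    nlinarith
  have hcr : ContinuousOn (fun τ => rho m s τ) (Set.Icc 0 (1 / 2)) := by
    have hc : ContinuousOn (fun τ : ℝ => τ / (2 * (1 - τ))) (Set.Icc 0 (1 / 2)) := by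
      refine ContinuousOn.div (by fun_prop) (by fun_prop) fun x hx => ?_
      have := hx.2
      have : 0 < 1 - x := by linarith
      positivity
    have hc' : ContinuousOn (fun τ : ℝ => ((s : ℝ) + 2) * τ / (2 * s * (1 - τ)))
        (Set.Icc 0 (1 / 2)) := by
      refine ContinuousOn.div (by fun_prop) (by fun_prop) fun x hx => ?_
      have := hx.2
      have : 0 < 1 - x := by linarith
      positivity
    unfold rho
    fun_prop
  have hca : ContinuousOn (fun τ => aux m s τ) (Set.Icc 0 (1 / 2)) := by
    unfold aux
    refine ContinuousOn.sub (ContinuousOn.div (by fun_prop) (by fun_prop) fun x hx => ?_)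
      continuousOn_id
    exact (hden x hx.1 hx.2).ne'
  have hcomp : IsCompact (Set.Icc (0 : ℝ) (1 / 2) ∩ (fun τ => aux m s τ) ⁻¹' {0}) :=
    isCompact_Icc.of_isClosed_subset
      (hca.preimage_isClosed_of_isClosed isClosed_Icc isClosed_singleton)
      Set.inter_subset_left
  have hne : (Set.Icc (0 : ℝ) (1 / 2) ∩ (fun τ => aux m s τ) ⁻¹' {0}).Nonempty := by
    obtain ⟨x, hx, hx0⟩ := intermediate_value_Icc' (by norm_num) hca ⟨hf1.le, hf0.le⟩
    exact ⟨x, hx, hx0⟩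
  obtain ⟨x, ⟨hx, hx0⟩, hmin⟩ := hcomp.exists_isLeast hne
  have hx0' : aux m s x = 0 := hx0
  have hxpos : 0 < x := by
    rcases hx.1.lt_or_eq with h | h
    · exact h
    · rw [← h] at hx0'
      exact absurd hx0' hf0.ne'
  have hleast : IsLeast {τ : ℝ | aux m s τ = 0 ∧ 0 < τ ∧ τ < 1} x := by
    refine ⟨⟨hx0', hxpos, by linarith [hx.2]⟩, ?_⟩
    rintro y ⟨hy0, hy, -⟩
    rcases le_total y (1 / 2) with h | h
    · exact hmin ⟨⟨hy.le, h⟩, hy0⟩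
    · exact hx.2.trans h
  have : Gamma m s = x := hleast.csInf_eq
  rw [this]
  exact hleast

end Heine

/-! The number `phi s P q a` is governed by the formal solution `f` of `P(z) f(z) = P(z) + a z^s
f(z/q)`. Evaluating this equation at `q^{-k}` and iterating gives `φ = S_k + t_k f(q^{-k})` for
large `k`, where `t_k` are the terms of the series and `S_k` its partial sums. Good rational
approximations to the `f_i` near `0` therefore give simultaneous approximations to the values
`φ(α_i)`.

Siegel's lemma provides `u₀` of degree at most `n` such that `f_i u₀` is, up to order `n + v_i`, a
polynomial `u_i` of degree at most `n` (`exists_pade`); the weights satisfy `2 ∑ v_i ≤ n`, so the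
coefficients of `u₀` stay of size about `|a|^{9n²/8}`. Evaluating at `q^{-k}` and clearing
denominators yields integers `X`, `Y_i` with `X φ(α_i) - Y_i` small (`approximation_bounds`).

The form `l₀ X + ∑ l_i Y_i` must be nonzero. The functional equations give a semilinear operator
that turns one approximation into others of the same order, and the determinant of `m + 1` iterates
does not vanish identically (`det_poincareStep_iterate_ne_zero`). The conditions on `α_i` are what
this needs: they exclude proportionality between two components and rational solutions of a single
equation. Comparing degree and order at `0`, some `k` in a window of length about `n - ∑ v_i` works
(`exists_form_ne_zero`).

Taking `∑ v_i = n/2` and starting the window at `ρ₀ n` places `k` between `ρ₀ n` and `(ρ₀ + 1/2) n`,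
up to constants. The weights are adapted to the `|l_i|`, which is possible once `log H / log |a|` is
at most about `δ n²`, while `log |X| / log |a|` is at most about `ν n²`. The exponent is `ν/δ = μ`;
`ρ₀` minimises this quotient, and `γ < Γ` says that `δ > 0`. -/

namespace Heine

/-! ### Dilations of polynomials and absence of rational solutions of the functional equation. -/

section Dilate

variable {F : Type*} [Field F]

/-- The substitution `p(X) ↦ p(c X)`. -/
noncomputable def dilate (c : F) : F[X] →+* F[X] := compRingHom (C c * X)

theorem dilate_apply (c : F) (p : F[X]) : dilate c p = p.comp (C c * X) := rfl

theorem coeff_dilate (c : F) (p : F[X]) (n : ℕ) : (dilate c p).coeff n = p.coeff n * c ^ n :=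
  comp_C_mul_X_coeff

@[simp] theorem dilate_C (c x : F) : dilate c (C x) = C x := by simp [dilate_apply]

@[simp] theorem dilate_X (c : F) : dilate c X = C c * X := by simp [dilate_apply]

theorem eval_dilate (c x : F) (p : F[X]) : (dilate c p).eval x = p.eval (c * x) := by
  simp [dilate_apply, eval_comp]

theorem dilate_dilate_inv {c : F} (hc : c ≠ 0) (p : F[X]) : dilate c (dilate c⁻¹ p) = p := by
  ext n
  rw [coeff_dilate, coeff_dilate, mul_assoc, ← mul_pow, inv_mul_cancel₀ hc, one_pow, mul_one]

theorem dilate_inv_dilate {c : F} (hc : c ≠ 0) (p : F[X]) : dilate c⁻¹ (dilate c p) = p := by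
  ext n
  rw [coeff_dilate, coeff_dilate, mul_assoc, ← mul_pow, mul_inv_cancel₀ hc, one_pow, mul_one]

theorem dilate_ne_zero {c : F} (hc : c ≠ 0) {p : F[X]} (hp : p ≠ 0) : dilate c p ≠ 0 := by
  intro h
  apply hp
  rw [← dilate_inv_dilate hc p, h, map_zero]

theorem natDegree_dilate {c : F} (hc : c ≠ 0) (p : F[X]) :
    (dilate c p).natDegree = p.natDegree := by
  rw [dilate_apply, natDegree_comp, natDegree_C_mul_X c hc, mul_one]

theorem leadingCoeff_dilate {c : F} (hc : c ≠ 0) (p : F[X]) :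
    (dilate c p).leadingCoeff = p.leadingCoeff * c ^ p.natDegree := by
  rw [leadingCoeff, natDegree_dilate hc, coeff_dilate, leadingCoeff]

/-- A polynomial not vanishing at `0` that divides its own dilation is constant. -/
theorem natDegree_eq_zero_of_dvd_dilate {c : F} (hc : c ≠ 0) (hc1 : ∀ n : ℕ, 1 ≤ n → c ^ n ≠ 1)
    {p : F[X]} (hp : p.coeff 0 ≠ 0) (h : p ∣ dilate c p) : p.natDegree = 0 := by
  obtain ⟨w, hw⟩ := h
  have hp0 : p ≠ 0 := by
    rintro rfl
    simp at hp
  have hw0 : w ≠ 0 := by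
    rintro rfl
    exact dilate_ne_zero hc hp0 (by simpa using hw)
  have hdeg := congrArg natDegree hw
  rw [natDegree_dilate hc, natDegree_mul hp0 hw0] at hdeg
  obtain ⟨x, rfl⟩ := natDegree_eq_zero.1 (show w.natDegree = 0 by omega)
  -- The constant cofactor equals `1` by comparing constant coefficients; the leading coefficients
  -- then give `c ^ deg p = 1`.
  have h0 := congrArg (fun r => coeff r 0) hw
  simp only [coeff_dilate, pow_zero, mul_one, coeff_mul_C] at h0
  have hx : x = 1 := by
    have : p.coeff 0 * (x - 1) = 0 := by linear_combination -h0
    rcases mul_eq_zero.1 this with h | h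
    · exact absurd h hp
    · linear_combination h
  have hl := congrArg leadingCoeff hw
  rw [leadingCoeff_dilate hc, hx, C_1, mul_one] at hl
  by_contra hne
  apply hc1 _ (Nat.one_le_iff_ne_zero.2 hne)
  have : p.leadingCoeff * (c ^ p.natDegree - 1) = 0 := by linear_combination hl
  rcases mul_eq_zero.1 this with h | h
  · exact absurd (leadingCoeff_eq_zero.1 h) hp0
  · linear_combination h

variable {s : ℕ} {P : F[X]} {q a : F}

/-- For coprime `g`, `h` the equation forces `h` to divide `z^s h(qz)`. The part of `h` prime to `z`
then divides its own dilation, so `h = c z^k`. The value at `0` rules out `k > 0`; for `k = 0`,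
degrees and leading coefficients give `deg P = s` and `a = P_s q^{deg g}`, the excluded case. -/
theorem not_isCoprime_of_poincare_eq (hs : 1 ≤ s) (hP0 : P.eval 0 ≠ 0)
    (hq0 : q ≠ 0) (hq1 : ∀ n : ℕ, 1 ≤ n → q ^ n ≠ 1) (ha : a ≠ 0)
    (haP : P.natDegree < s ∨ (P.natDegree = s ∧ ∀ n : ℕ, 1 ≤ n → a ≠ P.leadingCoeff * q ^ n))
    {g h : F[X]} (hh : h ≠ 0)
    (heq : h * dilate q (P * (g + h)) = dilate q (C a * X ^ s * h) * g) : ¬ IsCoprime g h := by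
  intro hcop
  have hPne : P ≠ 0 := by
    rintro rfl
    simp at hP0
  have hdvd : h ∣ X ^ s * dilate q h := by
    have h1 : h ∣ dilate q (C a * X ^ s * h) * g := ⟨_, heq.symm⟩
    have h2 : h ∣ dilate q (C a * X ^ s * h) := hcop.symm.dvd_of_dvd_mul_right h1
    have h3 : dilate q (C a * X ^ s * h) = C (a * q ^ s) * (X ^ s * dilate q h) := by
      simp only [map_mul, map_pow, dilate_C, dilate_X, mul_pow]
      ring
    rw [h3] at h2
    have hu : IsUnit (C (a * q ^ s)) := isUnit_C.2 (IsUnit.mk0 _ (mul_ne_zero ha (pow_ne_zero _ hq0)))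
    exact (hu.dvd_mul_left).1 h2
  obtain ⟨h1, hh1, hnd⟩ := exists_eq_pow_rootMultiplicity_mul_and_not_dvd h hh 0
  generalize h.rootMultiplicity 0 = k at hh1
  rw [C_0, sub_zero] at hh1 hnd
  have hc0 : h1.coeff 0 ≠ 0 := fun hc => hnd (X_dvd_iff.2 hc)
  have hcopX : IsCoprime h1 X := by
    have := (Polynomial.irreducible_X (R := F)).coprime_iff_not_dvd.2 hnd
    exact this.symm
  have hdeg0 : h1.natDegree = 0 := by
    apply natDegree_eq_zero_of_dvd_dilate hq0 hq1 hc0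
    have h2 : h1 ∣ X ^ s * dilate q h := dvd_trans ⟨X ^ k, by rw [hh1]; ring⟩ hdvd
    have h3 : X ^ s * dilate q h = X ^ (s + k) * (C (q ^ k) * dilate q h1) := by
      rw [hh1]
      simp only [map_mul, map_pow, dilate_X, mul_pow]
      ring
    rw [h3] at h2
    have h4 := (hcopX.pow_right (n := s + k)).dvd_of_dvd_mul_left h2
    have hu : IsUnit (C (q ^ k)) := isUnit_C.2 (IsUnit.mk0 _ (pow_ne_zero _ hq0))
    exact (hu.dvd_mul_left).1 h4
  obtain ⟨c, rfl⟩ := natDegree_eq_zero.1 hdeg0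
  have hc : c ≠ 0 := by simpa using hc0
  have heq2 : dilate q P * (dilate q g + C (c * q ^ k) * X ^ k) = C (a * q ^ (s + k)) * X ^ s * g := by
    have h5 : (X ^ k * C c : F[X]) ≠ 0 := hh1 ▸ hh
    apply mul_left_cancel₀ h5
    rw [hh1] at heq
    simp only [map_mul, map_pow, map_add, dilate_X, dilate_C, mul_pow] at heq ⊢
    linear_combination heq
  have hev := congrArg (eval 0) heq2
  have hs0 : s ≠ 0 := by omega
  simp only [eval_mul, eval_add, eval_dilate, mul_zero, eval_C, eval_pow, eval_X,
    zero_pow hs0, zero_mul] at hev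
  have hev := (mul_eq_zero.1 hev).resolve_left hP0
  rcases Nat.eq_zero_or_pos k with rfl | hk
  · simp only [pow_zero, mul_one, add_zero] at hev heq2
    have hg0 : g.eval 0 ≠ 0 := by
      intro h0
      rw [h0, zero_add] at hev
      exact hc hev
    have hgne : g ≠ 0 := by
      rintro rfl
      simp at hg0
    -- A constant `g` equals `-c`, which kills the left side but not the right; for positive degree
    -- the leading terms are compared.
    rcases Nat.eq_zero_or_pos g.natDegree with hD | hD
    · obtain ⟨x, rfl⟩ := natDegree_eq_zero.1 hD
      rw [eval_C] at hev
      rw [dilate_C, ← C_add, hev, C_0, mul_zero] at heq2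
      have : C (a * q ^ s) * X ^ s * C x ≠ 0 := by
        refine mul_ne_zero (mul_ne_zero ?_ (pow_ne_zero _ X_ne_zero)) hgne
        exact C_ne_zero.2 (mul_ne_zero ha (pow_ne_zero _ hq0))
      exact this heq2.symm
    · have hdne := dilate_ne_zero hq0 hgne
      have hlt : (C c).degree < (dilate q g).degree := by
        refine lt_of_le_of_lt degree_C_le ?_
        rw [← natDegree_pos_iff_degree_pos, natDegree_dilate hq0]
        exact hD
      have hl1 : (dilate q g + C c).leadingCoeff = g.leadingCoeff * q ^ g.natDegree := by
        rw [leadingCoeff_add_of_degree_lt' hlt, leadingCoeff_dilate hq0]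
      have hd1 : (dilate q g + C c).natDegree = g.natDegree := by
        rw [natDegree_add_C, natDegree_dilate hq0]
      have hne1 : dilate q g + C c ≠ 0 := by
        intro h0
        rw [h0, natDegree_zero] at hd1
        omega
      have haq : a * q ^ s ≠ 0 := mul_ne_zero ha (pow_ne_zero _ hq0)
      have hdd := congrArg natDegree heq2
      rw [natDegree_mul (dilate_ne_zero hq0 hPne) hne1, hd1, natDegree_dilate hq0, mul_assoc,
        natDegree_C_mul haq, natDegree_mul (pow_ne_zero _ X_ne_zero) hgne, natDegree_X_pow] at hdd
      have hPs : P.natDegree = s := by omega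
      have hll := congrArg leadingCoeff heq2
      simp only [leadingCoeff_mul, hl1, leadingCoeff_dilate hq0, leadingCoeff_C,
        leadingCoeff_X_pow, mul_one, hPs] at hll
      rcases haP with h | ⟨-, h⟩
      · omega
      · apply h _ hD
        have hgl : g.leadingCoeff ≠ 0 := leadingCoeff_ne_zero.2 hgne
        have hqs : q ^ s ≠ 0 := pow_ne_zero _ hq0
        apply mul_left_cancel₀ (mul_ne_zero hgl hqs)
        linear_combination -hll
  · rw [zero_pow hk.ne', mul_zero, add_zero] at hev
    have hXg : X ∣ g := X_dvd_iff.2 (by rw [coeff_zero_eq_eval_zero]; exact hev)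
    have hXh : X ∣ h := hh1 ▸ (dvd_pow_self X hk.ne').mul_right _
    exact not_isUnit_X (hcop.isUnit_of_dvd' hXg hXh)

/-- The first order equation `w(z) = 1 + a z^s P(z)⁻¹ w(z/q)` has no rational solution
`w = -g/h`. -/
theorem poincare_eq_no_rational (hs : 1 ≤ s) (hP0 : P.eval 0 ≠ 0)
    (hq0 : q ≠ 0) (hq1 : ∀ n : ℕ, 1 ≤ n → q ^ n ≠ 1) (ha : a ≠ 0)
    (haP : P.natDegree < s ∨ (P.natDegree = s ∧ ∀ n : ℕ, 1 ≤ n → a ≠ P.leadingCoeff * q ^ n))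
    {g h : F[X]} (hh : h ≠ 0) :
    h * dilate q (P * (g + h)) ≠ dilate q (C a * X ^ s * h) * g := by
  intro heq
  classical
  let _ := EuclideanDomain.gcdMonoid F[X]
  obtain ⟨g', h', hg', hh', hunit⟩ := extract_gcd g h
  have hcop : IsCoprime g' h' := (gcd_isUnit_iff g' h').1 hunit
  generalize gcd g h = d at hg' hh'
  have hd0 : d ≠ 0 := by
    rintro rfl
    exact hh (by rw [hh', zero_mul])
  subst hg' hh'
  have hh'0 : h' ≠ 0 := right_ne_zero_of_mul hh
  refine not_isCoprime_of_poincare_eq hs hP0 hq0 hq1 ha haP hh'0 ?_ hcop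
  -- Both sides are linear in `(g, h)` and also in their dilations, so a common factor `d`
  -- contributes `d(z) d(qz)`.
  apply mul_left_cancel₀ (mul_ne_zero hd0 (dilate_ne_zero hq0 hd0))
  simp only [map_mul, map_add] at heq ⊢
  linear_combination heq

end Dilate

/-! ### The semilinear operator, its dual, and independence of its iterates. -/

section Iterates

variable {F : Type*} [Field F] {m : ℕ}

/-- The semilinear operator attached to the equations `P(z) f_i(z) = P(z) + α_i z^s f_i(z/q)`:
it sends approximations `(u₀, u₁, …, u_m)` to `f_i u₀ ≈ u_i` to new ones. -/
noncomputable def poincareStep (s : ℕ) (P : F[X]) (q : F) (α : Fin m → F)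
    (u : Fin (m + 1) → F[X]) : Fin (m + 1) → F[X] :=
  Fin.cons (P * dilate q⁻¹ (u 0))
    (fun i => P * dilate q⁻¹ (u 0) + C (α i) * X ^ s * dilate q⁻¹ (u i.succ))

variable {s : ℕ} {P : F[X]} {q : F} {α : Fin m → F}

theorem poincareStep_zero (u : Fin (m + 1) → F[X]) :
    poincareStep s P q α u 0 = P * dilate q⁻¹ (u 0) := rfl

theorem poincareStep_succ (u : Fin (m + 1) → F[X]) (i : Fin m) :
    poincareStep s P q α u i.succ =
      P * dilate q⁻¹ (u 0) + C (α i) * X ^ s * dilate q⁻¹ (u i.succ) := rfl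

theorem poincareStep_sum {ι : Type*} [Fintype ι] (c : ι → F[X]) (u : ι → Fin (m + 1) → F[X])
    (j : Fin (m + 1)) :
    poincareStep s P q α (fun j => ∑ r, c r * u r j) j =
      ∑ r, dilate q⁻¹ (c r) * poincareStep s P q α (u r) j := by
  refine Fin.cases ?_ (fun i => ?_) j
  · simp only [poincareStep_zero, map_sum, map_mul, Finset.mul_sum]
    exact Finset.sum_congr rfl fun _ _ => by ring
  · simp only [poincareStep_succ, map_sum, map_mul, Finset.mul_sum]
    rw [← Finset.sum_add_distrib]
    exact Finset.sum_congr rfl fun _ _ => by ring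

/-- Semilinearity over `dilate q⁻¹` carries a linear relation among vectors to a relation among
their images, with dilated coefficients. -/
theorem poincareStep_iterate_sum {ι : Type*} [Fintype ι] (c : ι → F[X])
    (u : ι → Fin (m + 1) → F[X]) (hrel : ∀ j, ∑ r, c r * u r j = 0) (t : ℕ) (j : Fin (m + 1)) :
    ∑ r, (dilate q⁻¹)^[t] (c r) * (poincareStep s P q α)^[t] (u r) j = 0 := by
  induction t generalizing j with
  | zero => exact hrel j
  | succ t ih =>
    simp only [Function.iterate_succ_apply']
    rw [← poincareStep_sum]
    have h : (fun j => ∑ r, (dilate q⁻¹)^[t] (c r) * (poincareStep s P q α)^[t] (u r) j) =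
      fun _ => 0 := funext ih
    rw [h]
    refine Fin.cases ?_ (fun i => ?_) j
    · simp [poincareStep_zero]
    · simp [poincareStep_succ]

theorem dilate_iterate_ne_zero {c : F} (hc : c ≠ 0) {p : F[X]} (hp : p ≠ 0) (t : ℕ) :
    (dilate c)^[t] p ≠ 0 := by
  induction t with
  | zero => exact hp
  | succ t ih =>
    rw [Function.iterate_succ_apply']
    exact dilate_ne_zero hc ih

theorem natDegree_poincareStep_iterate_le (hq0 : q ≠ 0) (hP : P.natDegree ≤ s) {n : ℕ}
    {u : Fin (m + 1) → F[X]} (hu : ∀ j, (u j).natDegree ≤ n) (r : ℕ) (j : Fin (m + 1)) :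
    ((poincareStep s P q α)^[r] u j).natDegree ≤ n + r * s := by
  induction r generalizing j with
  | zero => simpa using hu j
  | succ r ih =>
    have hA : (P * dilate q⁻¹ ((poincareStep s P q α)^[r] u 0)).natDegree ≤ n + (r + 1) * s := by
      refine natDegree_mul_le.trans ?_
      rw [natDegree_dilate (inv_ne_zero hq0)]
      linarith [ih 0]
    rw [Function.iterate_succ_apply']
    refine Fin.cases hA (fun i => ?_) j
    rw [poincareStep_succ]
    refine natDegree_add_le_of_degree_le hA ?_
    refine natDegree_mul_le.trans ?_
    rw [natDegree_dilate (inv_ne_zero hq0)]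
    have h1 := natDegree_C_mul_X_pow_le (α i) s
    linarith [ih i.succ]

/-- If a vector annihilates the first `m + 1` of the iterates of `u`, and these are dependent, it
annihilates all iterates. -/
theorem exists_annihilator_of_det_eq_zero (hq0 : q ≠ 0) (u : Fin (m + 1) → F[X])
    (hdet : (Matrix.of fun r : Fin (m + 1) => (poincareStep s P q α)^[r] u).det = 0) :
    ∃ v : Fin (m + 1) → F[X], v ≠ 0 ∧
      ∀ r : ℕ, ∑ j, (poincareStep s P q α)^[r] u j * v j = 0 := by
  classical
  obtain ⟨v, hv0, hv⟩ := Matrix.exists_mulVec_eq_zero_iff.2 hdet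
  obtain ⟨c, hc0, hc⟩ := Matrix.exists_vecMul_eq_zero_iff.2 hdet
  have hv' : ∀ r : Fin (m + 1), ∑ j, (poincareStep s P q α)^[r] u j * v j = 0 := fun r => by
    have := congrFun hv r
    simpa [Matrix.mulVec, dotProduct] using this
  have hc' : ∀ j, ∑ r : Fin (m + 1), c r * (poincareStep s P q α)^[r] u j = 0 := fun j => by
    have := congrFun hc j
    simpa [Matrix.vecMul, dotProduct] using this
  obtain ⟨k0, hk0⟩ := Function.ne_iff.1 hc0
  -- With `k` the last index having `c k ≠ 0`, the `k`-th iterate depends on the earlier ones over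
  -- the function field. Applying the operator `t` more times gives the same for the iterate `t +
  -- k`, so annihilation propagates by strong induction.
  set S := Finset.univ.filter fun k => c k ≠ 0
  have hS : S.Nonempty := ⟨k0, by simpa [S] using hk0⟩
  set k := S.max' hS
  have hk : c k ≠ 0 := by
    have := S.max'_mem hS
    simpa [S] using this
  have hkmax : ∀ r, k < r → c r = 0 := fun r hr => by
    by_contra h
    exact absurd (S.le_max' r (by simpa [S] using h)) (not_le.2 hr)
  refine ⟨v, hv0, fun r => ?_⟩
  induction r using Nat.strong_induction_on with
  | _ r ih =>
    rcases lt_or_ge r (m + 1) with h | h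
    · exact hv' ⟨r, h⟩
    · obtain ⟨t, ht⟩ : ∃ t, r = k + t := ⟨r - k, by have := k.2; omega⟩
      have hrel := fun j => poincareStep_iterate_sum (s := s) (P := P) (q := q) (α := α) c _ hc' t j
      have h1 : ∑ j, (∑ i : Fin (m + 1), (dilate q⁻¹)^[t] (c i) *
          (poincareStep s P q α)^[t] ((poincareStep s P q α)^[i] u) j) * v j = 0 := by
        simp [hrel]
      simp only [Finset.sum_mul, mul_assoc] at h1
      rw [Finset.sum_comm] at h1
      simp only [← Finset.mul_sum, ← Function.iterate_add_apply] at h1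
      rw [Finset.sum_eq_single k] at h1
      · obtain rfl : r = t + k := by omega
        exact (mul_eq_zero.1 h1).resolve_left
          (dilate_iterate_ne_zero (inv_ne_zero hq0) hk t)
      · intro i _ hik
        rcases lt_or_gt_of_ne hik with h2 | h2
        · rw [ih (t + i) (by have : (i : ℕ) < k := h2; omega), mul_zero]
        · rw [hkmax i h2]
          have : ∀ t : ℕ, (dilate q⁻¹)^[t] (0 : F[X]) = 0 := fun t =>
            Function.iterate_fixed (map_zero _) t
          rw [this, zero_mul]
      · simp

/-- The operator on annihilators dual to `poincareStep`. -/
noncomputable def poincareDual (s : ℕ) (P : F[X]) (q : F) (α : Fin m → F)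
    (v : Fin (m + 1) → F[X]) : Fin (m + 1) → F[X] :=
  Fin.cons (dilate q (P * (v 0 + ∑ i : Fin m, v i.succ)))
    (fun i => dilate q (C (α i) * X ^ s * v i.succ))

/-- Adjointness up to dilation: a vector annihilating all iterates of `u` is sent by `poincareDual`
to another one. -/
theorem sum_mul_poincareDual (hq0 : q ≠ 0) (u v : Fin (m + 1) → F[X]) :
    ∑ j, u j * poincareDual s P q α v j = dilate q (∑ j, poincareStep s P q α u j * v j) := by
  have h1 : ∀ i : Fin m, dilate q (poincareStep s P q α u i.succ * v i.succ) =
      u 0 * dilate q P * dilate q (v i.succ) + u i.succ * dilate q (C (α i) * X ^ s * v i.succ) := by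
    intro i
    rw [poincareStep_succ]
    simp only [map_mul, map_add, dilate_dilate_inv hq0]
    ring
  have h2 : ∀ i : Fin m, poincareDual s P q α v i.succ = dilate q (C (α i) * X ^ s * v i.succ) :=
    fun _ => rfl
  have h3 : poincareDual s P q α v 0 = dilate q (P * (v 0 + ∑ i : Fin m, v i.succ)) := rfl
  rw [Fin.sum_univ_succ, Fin.sum_univ_succ, map_add, map_sum, h3, poincareStep_zero]
  simp only [h1, h2]
  rw [Finset.sum_add_distrib, ← Finset.mul_sum, ← map_sum, map_mul, map_mul, map_mul, map_add,
    dilate_dilate_inv hq0]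
  ring

/-- If the determinant vanished, an annihilator of all iterates with fewest nonzero components would
be proportional to its dual image. Proportionality of two components contradicts the condition on
`α_i / α_j`; a single surviving component yields a rational solution of one functional equation. -/
theorem det_poincareStep_iterate_ne_zero (hs : 1 ≤ s) (hP0 : P.eval 0 ≠ 0)
    (hq0 : q ≠ 0) (hq1 : ∀ n : ℕ, 1 ≤ n → q ^ n ≠ 1) (hα0 : ∀ i, α i ≠ 0)
    (hαq : ∀ i j, i ≠ j → ∀ l : ℤ, α i ≠ α j * q ^ l)
    (hαP : P.natDegree < s ∨
      (P.natDegree = s ∧ ∀ i, ∀ n : ℕ, 1 ≤ n → α i ≠ P.leadingCoeff * q ^ n))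
    {u : Fin (m + 1) → F[X]} (hu : u 0 ≠ 0) :
    (Matrix.of fun r : Fin (m + 1) => (poincareStep s P q α)^[r] u).det ≠ 0 := by
  classical
  intro hdet
  set A : Set (Fin (m + 1) → F[X]) :=
    {v | v ≠ 0 ∧ ∀ r : ℕ, ∑ j, (poincareStep s P q α)^[r] u j * v j = 0} with hA
  have hAne : A.Nonempty := exists_annihilator_of_det_eq_zero hq0 u hdet
  -- Component `0` is not counted: since `u 0 ≠ 0`, an annihilator whose other components vanish is
  -- zero.
  obtain ⟨v, ⟨hv0, hv⟩, hmin⟩ := (measure fun v : Fin (m + 1) → F[X] =>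
    (Finset.univ.filter fun i : Fin m => v i.succ ≠ 0).card).wf.has_min A hAne
  have hzero : ∀ w : Fin (m + 1) → F[X],
      (∀ r : ℕ, ∑ j, (poincareStep s P q α)^[r] u j * w j = 0) → (∀ i : Fin m, w i.succ = 0) →
      w = 0 := by
    intro w hw hw0
    have h0 := hw 0
    rw [Fin.sum_univ_succ] at h0
    simp only [hw0, mul_zero, Finset.sum_const_zero, add_zero, Function.iterate_zero, id] at h0
    funext j
    refine Fin.cases ((mul_eq_zero.1 h0).resolve_left hu) (fun i => hw0 i) j
  obtain ⟨i, hi⟩ : ∃ i : Fin m, v i.succ ≠ 0 := by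
    by_contra! h
    exact hv0 (hzero v hv h)
  set v' := poincareDual s P q α v with hv'
  have hv'A : ∀ r : ℕ, ∑ j, (poincareStep s P q α)^[r] u j * v' j = 0 := by
    intro r
    rw [hv', sum_mul_poincareDual hq0, ← Function.iterate_succ_apply' (poincareStep s P q α), hv,
      map_zero]
  -- This combination annihilates too and loses component `i`, so minimality forces it to be zero.
  set w : Fin (m + 1) → F[X] := fun j => v i.succ * v' j - v' i.succ * v j with hw
  have hwA : ∀ r : ℕ, ∑ j, (poincareStep s P q α)^[r] u j * w j = 0 := by
    intro r
    have h1 : ∑ j, (poincareStep s P q α)^[r] u j * w j =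
        v i.succ * ∑ j, (poincareStep s P q α)^[r] u j * v' j -
          v' i.succ * ∑ j, (poincareStep s P q α)^[r] u j * v j := by
      rw [Finset.mul_sum, Finset.mul_sum, ← Finset.sum_sub_distrib]
      exact Finset.sum_congr rfl fun j _ => by simp only [hw]; ring
    rw [h1, hv'A, hv, mul_zero, mul_zero, sub_zero]
  have hv's : ∀ j : Fin m, v' j.succ = dilate q (C (α j) * X ^ s * v j.succ) := fun j => rfl
  have hw0 : w = 0 := by
    by_contra hne
    refine hmin w ⟨hne, hwA⟩ (Finset.card_lt_card ?_)
    rw [Finset.ssubset_iff_of_subset]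
    · exact ⟨i, by simpa using hi, by simp [hw, mul_comm]⟩
    · intro j hj
      simp only [Finset.mem_filter, Finset.mem_univ, true_and] at hj ⊢
      intro h0
      apply hj
      simp only [hw, hv's, h0, mul_zero, map_zero, sub_zero]
  have hsupp : ∀ j : Fin m, j ≠ i → v j.succ = 0 := by
    intro j hji
    by_contra hj
    have h1 := congrFun hw0 j.succ
    simp only [hw, hv's, Pi.zero_apply] at h1
    have h2 := congrArg leadingCoeff (sub_eq_zero.1 h1)
    have hci : (C (α i) : F[X]) ≠ 0 := C_ne_zero.2 (hα0 i)
    have hcj : (C (α j) : F[X]) ≠ 0 := C_ne_zero.2 (hα0 j)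
    simp only [map_mul, map_pow, leadingCoeff_mul, leadingCoeff_dilate hq0, leadingCoeff_pow,
      leadingCoeff_C, leadingCoeff_X, natDegree_C, natDegree_X, pow_zero, mul_one, pow_one,
      one_mul] at h2
    have hli : (v i.succ).leadingCoeff ≠ 0 := leadingCoeff_ne_zero.2 hi
    have hlj : (v j.succ).leadingCoeff ≠ 0 := leadingCoeff_ne_zero.2 hj
    have hqs : q ^ s ≠ 0 := pow_ne_zero _ hq0
    have h3 : α j * q ^ (v j.succ).natDegree = α i * q ^ (v i.succ).natDegree := by
      apply mul_left_cancel₀ (mul_ne_zero (mul_ne_zero hli hlj) hqs)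
      linear_combination h2
    apply hαq j i hji ((v i.succ).natDegree - (v j.succ).natDegree)
    rw [zpow_sub₀ hq0, zpow_natCast, zpow_natCast, mul_div_assoc', eq_div_iff (pow_ne_zero _ hq0)]
    exact h3
  have h0 := congrFun hw0 0
  have hsum : ∑ j : Fin m, v j.succ = v i.succ :=
    Finset.sum_eq_single i (fun j _ hj => hsupp j hj) (by simp)
  have hv'0 : v' 0 = dilate q (P * (v 0 + v i.succ)) := by
    rw [← hsum]
    rfl
  simp only [hw, hv's, hv'0, Pi.zero_apply] at h0
  refine poincare_eq_no_rational hs hP0 hq0 hq1 (hα0 i) ?_ hi (sub_eq_zero.1 h0)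
  rcases hαP with h | ⟨h, h'⟩
  · exact Or.inl h
  · exact Or.inr ⟨h, h' i⟩

end Iterates

/-! ### Zero estimate: order and degree of the determinant, nonvanishing of linear forms. -/

section ZeroEstimate

variable {F : Type*} [Field F] {m s : ℕ} {P : F[X]} {q : F} {α : Fin m → F}

theorem coe_dilate (c : F) (p : F[X]) :
    ((dilate c p : F[X]) : PowerSeries F) = PowerSeries.rescale c (p : PowerSeries F) := by
  ext n
  rw [coeff_coe, coeff_dilate, PowerSeries.coeff_rescale, coeff_coe, mul_comm]

/-- By the functional equation, one step replaces the remainder `R(z)` by `α_i z^s R(z/q)`, so the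
order at `0` does not drop. -/
theorem X_pow_dvd_remainder_iterate {e : ℕ} {i : Fin m} {f : PowerSeries F}
    (hf : (P : PowerSeries F) * f = (P : PowerSeries F) + PowerSeries.C (α i) * PowerSeries.X ^ s *
      PowerSeries.rescale q⁻¹ f)
    {u : Fin (m + 1) → F[X]}
    (hu : PowerSeries.X ^ e ∣ (u i.succ : PowerSeries F) - f * (u 0 : PowerSeries F)) (r : ℕ) :
    PowerSeries.X ^ e ∣ ((poincareStep s P q α)^[r] u i.succ : PowerSeries F) -
      f * ((poincareStep s P q α)^[r] u 0 : PowerSeries F) := by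
  induction r with
  | zero => exact hu
  | succ r ih =>
    rw [Function.iterate_succ_apply']
    generalize (poincareStep s P q α)^[r] u = w at ih
    have h1 : ((poincareStep s P q α w i.succ : F[X]) : PowerSeries F) -
        f * (poincareStep s P q α w 0 : PowerSeries F) =
        PowerSeries.C (α i) * PowerSeries.X ^ s * PowerSeries.rescale q⁻¹
          ((w i.succ : PowerSeries F) - f * (w 0 : PowerSeries F)) := by
      rw [poincareStep_zero, poincareStep_succ, map_sub, map_mul, ← coe_dilate, ← coe_dilate]
      push_cast
      linear_combination (-(dilate q⁻¹ (w 0) : PowerSeries F)) * hf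
    rw [h1]
    refine Dvd.dvd.mul_left ?_ _
    rw [PowerSeries.X_pow_dvd_iff] at ih ⊢
    intro k hk
    rw [PowerSeries.coeff_rescale, ih k hk, mul_zero]

theorem prod_dvd_det {R n : Type*} [CommRing R] [Fintype n] [DecidableEq n] (d : n → R)
    (N : Matrix n n R) (h : ∀ i j, d j ∣ N i j) : ∏ j, d j ∣ N.det := by
  choose c hc using h
  have : N = Matrix.of fun i j => d j * (Matrix.of c) i j := by
    ext i j
    exact hc i j
  rw [this, Matrix.det_mul_row]
  exact dvd_mul_right _ _

/-- Subtracting `f_i` times column `0` from column `i + 1` turns the entries into remainders without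
changing the determinant. -/
theorem X_pow_dvd_det_iterate {e : Fin m → ℕ} {f : Fin m → PowerSeries F}
    (hf : ∀ i, (P : PowerSeries F) * f i = (P : PowerSeries F) + PowerSeries.C (α i) * PowerSeries.X ^ s *
      PowerSeries.rescale q⁻¹ (f i))
    {u : Fin (m + 1) → F[X]}
    (hu : ∀ i, PowerSeries.X ^ e i ∣ (u i.succ : PowerSeries F) - f i * (u 0 : PowerSeries F)) :
    X ^ (∑ i, e i) ∣ (Matrix.of fun r : Fin (m + 1) => (poincareStep s P q α)^[r] u).det := by
  set M := Matrix.of fun r : Fin (m + 1) => (poincareStep s P q α)^[r] u with hM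
  set M' := (coeToPowerSeries.ringHom (R := F)).mapMatrix M with hM'
  have hdet : ((M.det : F[X]) : PowerSeries F) = M'.det := by
    rw [hM', ← RingHom.map_det]
    rfl
  let c : Fin (m + 1) → PowerSeries F := Fin.cons 0 (fun i => -f i)
  let N : Matrix (Fin (m + 1)) (Fin (m + 1)) (PowerSeries F) :=
    Matrix.of fun r j => M' r j + c j * M' r 0
  have hN : N.det = M'.det := by
    rw [← Matrix.det_transpose N, ← Matrix.det_transpose M']
    exact Matrix.det_eq_of_forall_row_eq_smul_add_const c 0 rfl (fun _ _ => rfl)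
  let d : Fin (m + 1) → PowerSeries F := Fin.cons 1 (fun i => PowerSeries.X ^ e i)
  have hd : ∏ j, d j ∣ N.det := by
    apply prod_dvd_det
    intro r j
    refine Fin.cases (one_dvd _) (fun i => ?_) j
    have := X_pow_dvd_remainder_iterate (hf i) (hu i) r
    convert! this using 1
    change _ + -f i * _ = _
    rw [neg_mul, ← sub_eq_add_neg]
    rfl
  have hprod : ∏ j, d j = PowerSeries.X ^ (∑ i, e i) := by
    rw [Fin.prod_univ_succ, ← Finset.prod_pow_eq_pow_sum]
    exact one_mul _
  rw [hprod, hN, ← hdet, PowerSeries.X_pow_dvd_iff] at hd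
  rw [Polynomial.X_pow_dvd_iff]
  intro k hk
  rw [← coeff_coe]
  exact hd k hk

theorem natDegree_det_le {n : Type*} [Fintype n] [DecidableEq n] (M : Matrix n n F[X]) {d : ℕ}
    (hM : ∀ i j, (M i j).natDegree ≤ d) : M.det.natDegree ≤ Fintype.card n * d := by
  rw [Matrix.det_apply]
  refine natDegree_sum_le_of_forall_le _ _ fun σ _ => ?_
  refine (natDegree_smul_le _ _).trans ((natDegree_prod_le _ _).trans ?_)
  refine (Finset.sum_le_card_nsmul _ _ d fun i _ => hM _ _).trans ?_
  simp

/-- A nonzero polynomial cannot vanish at too many consecutive points `x⁰, x¹, …` with `x` not a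
root of unity. -/
theorem exists_eval_pow_ne_zero {x : F} (hx0 : x ≠ 0) (hx1 : ∀ n : ℕ, 1 ≤ n → x ^ n ≠ 1)
    {D : F[X]} (hD : D ≠ 0) (k : ℕ) : ∃ j ≤ D.natDegree, D.eval (x ^ (k + j)) ≠ 0 := by
  classical
  by_contra! h
  have hinj : Set.InjOn (fun j => x ^ (k + j)) (Finset.range (D.natDegree + 1) : Set ℕ) := by
    have key : ∀ i j : ℕ, i < j → x ^ (k + i) ≠ x ^ (k + j) := by
      intro i j hij heq
      apply hx1 (j - i) (by omega)
      apply mul_left_cancel₀ (pow_ne_zero (k + i) hx0)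
      rw [← pow_add, show k + i + (j - i) = k + j by omega, mul_one, heq]
    intro i _ j _ heq
    rcases lt_trichotomy i j with hij | hij | hij
    · exact absurd heq (key i j hij)
    · exact hij
    · exact absurd heq.symm (key j i hij)
  refine hD (eq_zero_of_natDegree_lt_card_of_eval_eq_zero' D
    ((Finset.range (D.natDegree + 1)).image fun j => x ^ (k + j)) ?_ ?_)
  · intro y hy
    obtain ⟨j, hj, rfl⟩ := Finset.mem_image.1 hy
    exact h j (Nat.lt_succ_iff.1 (Finset.mem_range.1 hj))
  · rw [Finset.card_image_of_injOn hinj, Finset.card_range]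
    exact Nat.lt_succ_self _

variable {t : Fin m → ℕ → F}

theorem eval_poincareStep_iterate_zero (u : Fin (m + 1) → F[X]) (r k : ℕ) :
    ((poincareStep s P q α)^[r] u 0).eval (q⁻¹ ^ k) =
      (∏ l ∈ Finset.range r, P.eval (q⁻¹ ^ (k + l))) * (u 0).eval (q⁻¹ ^ (k + r)) := by
  induction r generalizing k with
  | zero => simp
  | succ r ih =>
    rw [Function.iterate_succ_apply', poincareStep_zero, eval_mul, eval_dilate, ← pow_succ', ih,
      Finset.prod_range_succ']
    simp only [add_zero, show ∀ l, k + 1 + l = k + (l + 1) by intro l; ring]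
    ring

/-- Applying the operator `r` times and evaluating at `q^{-k}` gives, up to the factor `∏
P(q^{-(k+l)})`, the approximation from `u` itself at `q^{-(k+r)}`. A nonvanishing form in an iterate
thus becomes one in `u`. -/
theorem eval_poincareStep_iterate_succ
    (ht : ∀ i k, t i (k + 1) * P.eval (q⁻¹ ^ k) = t i k * α i * (q⁻¹ ^ k) ^ s)
    (u : Fin (m + 1) → F[X]) (i : Fin m) (r k : ℕ) :
    (∑ j ∈ Finset.range k, t i j) * ((poincareStep s P q α)^[r] u 0).eval (q⁻¹ ^ k) +
      t i k * ((poincareStep s P q α)^[r] u i.succ).eval (q⁻¹ ^ k) =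
    (∏ l ∈ Finset.range r, P.eval (q⁻¹ ^ (k + l))) *
      ((∑ j ∈ Finset.range (k + r), t i j) * (u 0).eval (q⁻¹ ^ (k + r)) +
        t i (k + r) * (u i.succ).eval (q⁻¹ ^ (k + r))) := by
  induction r generalizing k with
  | zero => simp
  | succ r ih =>
    have h := ih (k + 1)
    rw [Function.iterate_succ_apply', poincareStep_zero, poincareStep_succ, eval_mul, eval_add,
      eval_mul, eval_mul, eval_mul, eval_dilate, eval_dilate, ← pow_succ', eval_C, eval_pow, eval_X,
      Finset.prod_range_succ']
    simp only [add_zero, show ∀ l, k + 1 + l = k + (l + 1) by intro l; ring] at h ⊢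
    rw [Finset.sum_range_succ] at h
    linear_combination P.eval (q⁻¹ ^ k) * h -
      ((poincareStep s P q α)^[r] u i.succ).eval (q⁻¹ ^ (k + 1)) * ht i k

/-- Among sufficiently many consecutive `k`, some approximating form obtained from `u` at
`q^{-k}` does not annihilate a given nonzero vector `(l₀, l)`. -/
theorem exists_form_ne_zero (hs : 1 ≤ s) (hPdeg : P.natDegree ≤ s) (hP0 : P.eval 0 ≠ 0)
    (hq0 : q ≠ 0) (hq1 : ∀ n : ℕ, 1 ≤ n → q ^ n ≠ 1) (hα0 : ∀ i, α i ≠ 0)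
    (hαq : ∀ i j, i ≠ j → ∀ l : ℤ, α i ≠ α j * q ^ l)
    (hαP : P.natDegree < s ∨
      (P.natDegree = s ∧ ∀ i, ∀ n : ℕ, 1 ≤ n → α i ≠ P.leadingCoeff * q ^ n))
    {f : Fin m → PowerSeries F}
    (hf : ∀ i, (P : PowerSeries F) * f i = (P : PowerSeries F) + PowerSeries.C (α i) * PowerSeries.X ^ s *
      PowerSeries.rescale q⁻¹ (f i))
    (ht0 : ∀ i, t i 0 = 1)
    (ht : ∀ i k, t i (k + 1) * P.eval (q⁻¹ ^ k) = t i k * α i * (q⁻¹ ^ k) ^ s)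
    {u : Fin (m + 1) → F[X]} (hu0 : u 0 ≠ 0) {n : ℕ} (hun : ∀ j, (u j).natDegree ≤ n)
    {v : Fin m → ℕ}
    (hu : ∀ i, PowerSeries.X ^ (n + v i) ∣
      (u i.succ : PowerSeries F) - f i * (u 0 : PowerSeries F))
    {l₀ : F} {l : Fin m → F} (hl : ¬ (l₀ = 0 ∧ ∀ i, l i = 0)) (k₁ : ℕ) :
    ∃ k, k₁ ≤ k ∧ k + ∑ i, v i ≤ k₁ + n + ((m + 1) * (m * s) + m) ∧
      l₀ * (u 0).eval (q⁻¹ ^ k) + ∑ i, l i * ((∑ j ∈ Finset.range k, t i j) *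
        (u 0).eval (q⁻¹ ^ k) + t i k * (u i.succ).eval (q⁻¹ ^ k)) ≠ 0 := by
  have htne : ∀ i k, t i k ≠ 0 := by
    intro i k
    induction k with
    | zero => rw [ht0]; exact one_ne_zero
    | succ k ih =>
      have h1 : t i k * α i * (q⁻¹ ^ k) ^ s ≠ 0 :=
        mul_ne_zero (mul_ne_zero ih (hα0 i)) (pow_ne_zero _ (pow_ne_zero _ (inv_ne_zero hq0)))
      rw [← ht] at h1
      exact left_ne_zero_of_mul h1
  have hdet0 := det_poincareStep_iterate_ne_zero hs hP0 hq0 hq1 hα0 hαq hαP hu0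
  obtain ⟨D, hD⟩ := X_pow_dvd_det_iterate hf hu
  set M := Matrix.of fun r : Fin (m + 1) => (poincareStep s P q α)^[r] u with hM
  have hD0 : D ≠ 0 := by
    rintro rfl
    exact hdet0 (by rw [hD, mul_zero])
  -- Each of the at most `m` applications raises degrees by at most `s`. Hence `deg D ≤ n + (m + 1)
  -- m s - ∑ v_i`, which is the length of the window for `k`.
  have hdeg : D.natDegree + ∑ i, (n + v i) ≤ (m + 1) * (n + m * s) := by
    have h1 : M.det.natDegree ≤ Fintype.card (Fin (m + 1)) * (n + m * s) := by
      apply natDegree_det_le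
      intro r j
      refine (natDegree_poincareStep_iterate_le hq0 hPdeg hun r j).trans ?_
      have : (r : ℕ) ≤ m := Nat.lt_succ_iff.1 r.2
      gcongr
    rw [hD, natDegree_mul (pow_ne_zero _ X_ne_zero) hD0, natDegree_X_pow, Fintype.card_fin] at h1
    linarith
  have hx1 : ∀ n : ℕ, 1 ≤ n → q⁻¹ ^ n ≠ 1 := fun n hn h => hq1 n hn (by
    rwa [inv_pow, inv_eq_one] at h)
  obtain ⟨j, hj, hjne⟩ := exists_eval_pow_ne_zero (inv_ne_zero hq0) hx1 hD0 k₁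
  rw [Finset.sum_add_distrib, Finset.sum_const, Finset.card_univ, Fintype.card_fin,
    smul_eq_mul] at hdeg
  set k := k₁ + j with hk
  have hMk : ((evalRingHom (q⁻¹ ^ k)).mapMatrix M).det ≠ 0 := by
    rw [← RingHom.map_det, hD, map_mul, map_pow, coe_evalRingHom, eval_X]
    exact mul_ne_zero (pow_ne_zero _ (pow_ne_zero _ (inv_ne_zero hq0))) hjne
  -- The given form, rewritten in the evaluated approximations; it is nonzero because no `t i k`
  -- vanishes.
  let w : Fin (m + 1) → F := Fin.cons (l₀ + ∑ i, l i * ∑ j ∈ Finset.range k, t i j)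
    (fun i => l i * t i k)
  have hw : w ≠ 0 := by
    intro h0
    have hl' : ∀ i, l i = 0 := fun i =>
      (mul_eq_zero.1 (congrFun h0 i.succ)).resolve_right (htne i k)
    apply hl
    refine ⟨?_, hl'⟩
    have h1 : l₀ + ∑ i, l i * ∑ j ∈ Finset.range k, t i j = 0 := congrFun h0 0
    simpa [hl'] using h1
  obtain ⟨r, hr⟩ : ∃ r : Fin (m + 1), ((evalRingHom (q⁻¹ ^ k)).mapMatrix M).mulVec w r ≠ 0 := by
    by_contra! h
    exact hMk (Matrix.exists_mulVec_eq_zero_iff.1 ⟨w, hw, funext h⟩)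
  refine ⟨k + r, by omega, ?_, fun h0 => hr ?_⟩
  · have := r.2
    nlinarith
  · have h1 : ((evalRingHom (q⁻¹ ^ k)).mapMatrix M).mulVec w r =
        ((poincareStep s P q α)^[r] u 0).eval (q⁻¹ ^ k) *
          (l₀ + ∑ i, l i * ∑ j ∈ Finset.range k, t i j) +
        ∑ i, ((poincareStep s P q α)^[r] u i.succ).eval (q⁻¹ ^ k) * (l i * t i k) := by
      rw [Matrix.mulVec, dotProduct, Fin.sum_univ_succ]
      rfl
    rw [h1]
    have h2 : ((poincareStep s P q α)^[r] u 0).eval (q⁻¹ ^ k) *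
          (l₀ + ∑ i, l i * ∑ j ∈ Finset.range k, t i j) +
        ∑ i, ((poincareStep s P q α)^[r] u i.succ).eval (q⁻¹ ^ k) * (l i * t i k) =
        l₀ * ((poincareStep s P q α)^[r] u 0).eval (q⁻¹ ^ k) +
        ∑ i, l i * ((∑ j ∈ Finset.range k, t i j) *
          ((poincareStep s P q α)^[r] u 0).eval (q⁻¹ ^ k) +
          t i k * ((poincareStep s P q α)^[r] u i.succ).eval (q⁻¹ ^ k)) := by
      rw [mul_add, Finset.mul_sum, add_assoc, ← Finset.sum_add_distrib]
      congr 1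
      · ring
      · exact Finset.sum_congr rfl fun _ _ => by ring
    rw [h2]
    simp only [eval_poincareStep_iterate_succ ht u]
    rw [eval_poincareStep_iterate_zero]
    have h3 := congrArg (fun x => (∏ l ∈ Finset.range r, P.eval (q⁻¹ ^ (k + l))) * x) h0
    simp only [mul_zero, mul_add, Finset.mul_sum] at h3
    rw [← h3]
    congr 1
    · ring
    · exact Finset.sum_congr rfl fun _ _ => by ring

end ZeroEstimate

/-! ### Integers of `K` inside `ℂ`: the norm lower bound, denominators and Siegel's lemma. -/

section Integers

open NumberField

variable {K : Type*} [Field K]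

/-- The image in `ℂ` of the ring of integers. -/
noncomputable def intRange (σ : K →+* ℂ) : Subring ℂ := (σ.comp (algebraMap (𝓞 K) K)).range

theorem mem_intRange (σ : K →+* ℂ) (x : 𝓞 K) : σ (x : K) ∈ intRange σ := ⟨x, rfl⟩

variable [NumberField K]

/-- The embeddings of `K` are `σ` and possibly its conjugate. This is how the restriction on `K`
enters: the house is the absolute value, so nonzero integers have norm at least `1` and Siegel's
lemma controls `‖σ x‖`. -/
theorem norm_embedding_eq (hK : IsRatOrImagQuadratic K) (σ τ : K →+* ℂ) (x : K) :
    ‖τ x‖ = ‖σ x‖ := by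
  classical
  rcases hK with h | ⟨h, hc⟩
  · have hcard : Fintype.card (K →+* ℂ) = 1 := by rw [Embeddings.card, h]
    have := Fintype.card_le_one_iff_subsingleton.1 hcard.le
    rw [Subsingleton.elim τ σ]
  · have hcard : Fintype.card (K →+* ℂ) = 2 := by rw [Embeddings.card, h]
    have hne : σ ≠ ComplexEmbedding.conjugate σ := fun h0 =>
      IsTotallyComplex.complexEmbedding_not_isReal σ h0.symm
    have huniv : ({σ, ComplexEmbedding.conjugate σ} : Finset (K →+* ℂ)) = Finset.univ :=
      Finset.eq_univ_of_card _ (by rw [Finset.card_pair hne, hcard])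
    have hmem : τ ∈ ({σ, ComplexEmbedding.conjugate σ} : Finset (K →+* ℂ)) := by
      rw [huniv]
      exact Finset.mem_univ _
    rcases Finset.mem_insert.1 hmem with rfl | h1
    · rfl
    · rw [Finset.mem_singleton.1 h1, ComplexEmbedding.conjugate_coe_eq, RCLike.norm_conj]

theorem house_eq_norm (hK : IsRatOrImagQuadratic K) (σ : K →+* ℂ) (x : K) :
    house x = ‖σ x‖ := by
  apply le_antisymm
  · rw [house_eq_sup']
    have h : (Finset.univ.sup' Finset.univ_nonempty fun φ : K →+* ℂ => ‖φ x‖₊) ≤ ‖σ x‖₊ :=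
      Finset.sup'_le _ _ fun τ _ => NNReal.coe_le_coe.1 (norm_embedding_eq hK σ τ x).le
    exact NNReal.coe_le_coe.2 h
  · exact norm_embedding_le_house x σ

theorem one_le_norm_of_mem_intRange (hK : IsRatOrImagQuadratic K) (σ : K →+* ℂ) {x : ℂ}
    (hx : x ∈ intRange σ) (hx0 : x ≠ 0) : 1 ≤ ‖x‖ := by
  obtain ⟨y, rfl⟩ := hx
  change 1 ≤ ‖σ (y : K)‖
  rw [← house_eq_norm hK]
  apply one_le_house_of_isIntegral y.isIntegral_coe
  intro h
  apply hx0
  change σ (algebraMap (𝓞 K) K y) = 0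
  rw [h, map_zero]

theorem exists_denominator (σ : K →+* ℂ) {ι : Type*} [Finite ι] (f : ι → K) :
    ∃ d ∈ intRange σ, d ≠ 0 ∧ ∀ i, d * σ (f i) ∈ intRange σ := by
  obtain ⟨b, hb⟩ := IsLocalization.exist_integer_multiples_of_finite (nonZeroDivisors (𝓞 K)) f
  refine ⟨σ ((b : 𝓞 K) : K), mem_intRange σ _, ?_, fun i => ?_⟩
  · rw [_root_.map_ne_zero]
    exact RingOfIntegers.coe_ne_zero_iff.2 (nonZeroDivisors.ne_zero b.2)
  · obtain ⟨y, hy⟩ := hb i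
    rw [← map_mul]
    refine ⟨y, ?_⟩
    change σ (algebraMap (𝓞 K) K y) = _
    rw [hy, Algebra.smul_def]

/-- Siegel's lemma with constant `c` over a subring of `ℂ`, for systems with at least twice as many
unknowns as equations. -/
def SiegelBound (O : Subring ℂ) (c : ℝ) : Prop :=
  ∀ (ι κ : Type) [Fintype ι] [Fintype κ] (M : Matrix ι κ ℂ) (A : ℝ), 1 ≤ A →
    (∀ i j, M i j ∈ O) → (∀ i j, ‖M i j‖ ≤ A) → 0 < Fintype.card κ →
    2 * Fintype.card ι ≤ Fintype.card κ →
    ∃ x : κ → ℂ, x ≠ 0 ∧ (∀ j, x j ∈ O) ∧ M.mulVec x = 0 ∧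
      ∀ j, ‖x j‖ ≤ c * Fintype.card κ * A

theorem exists_siegelBound (hK : IsRatOrImagQuadratic K) (σ : K →+* ℂ) :
    ∃ c : ℝ, 1 ≤ c ∧ SiegelBound (intRange σ) c := by
  classical
  obtain ⟨c₁, hc₁⟩ : ∃ c₁ : ℝ, ∀ (ι κ : Type) [Fintype ι] [Fintype κ] (M : Matrix ι κ (𝓞 K)) (A : ℝ),
      M ≠ 0 → 0 < Fintype.card ι → Fintype.card ι < Fintype.card κ →
      (∀ i j, house (M i j : K) ≤ A) →
      ∃ ξ : κ → 𝓞 K, ξ ≠ 0 ∧ M.mulVec ξ = 0 ∧ ∀ l, house (ξ l : K) ≤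
        c₁ * (c₁ * (Fintype.card κ : ℕ) * A) ^
          (((Fintype.card ι : ℕ) : ℝ) / ((Fintype.card κ : ℕ) - (Fintype.card ι : ℕ))) :=
    ⟨_, fun ι κ _ _ M A hM h0 h1 hA => house.exists_ne_zero_int_vec_house_le K M hM h0 h1 rfl hA rfl⟩
  refine ⟨max 1 |c₁| * max 1 |c₁|, one_le_mul_of_one_le_of_one_le (le_max_left _ _)
    (le_max_left _ _), fun ι κ _ _ M A hA hM hMA hκ hικ => ?_⟩
  set c := max 1 |c₁| with hc
  have hc1 : 1 ≤ c := le_max_left _ _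
  have hcc : |c₁| ≤ c := le_max_right _ _
  have hκ1 : (1 : ℝ) ≤ Fintype.card κ := by exact_mod_cast hκ
  choose N hN using hM
  have hN' : ∀ i j, σ (N i j : K) = M i j := hN
  have hbase : 1 ≤ c * Fintype.card κ * A :=
    one_le_mul_of_one_le_of_one_le (one_le_mul_of_one_le_of_one_le hc1 hκ1) hA
  have hcb : 1 ≤ c * c * Fintype.card κ * A := by
    have := one_le_mul_of_one_le_of_one_le hc1 hbase
    linarith
  by_cases hN0 : (Matrix.of N) = 0
  -- The version of Siegel's lemma used requires a nonzero matrix; for the zero matrix any nonzero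
  -- integral vector does.
  · refine ⟨fun _ => 1, ?_, fun _ => one_mem _, ?_, fun j => by simpa using hcb⟩
    · obtain ⟨j⟩ := Fintype.card_pos_iff.1 hκ
      exact fun h => one_ne_zero (congrFun h j)
    · have hM0 : M = 0 := by
        ext i j
        have : N i j = 0 := congrFun (congrFun hN0 i) j
        rw [← hN', this]
        simp
      rw [hM0, Matrix.zero_mulVec]
  · have hι : 0 < Fintype.card ι := by
      rw [Fintype.card_pos_iff]
      by_contra h
      rw [not_nonempty_iff] at h
      exact hN0 (by ext i; exact h.elim i)
    obtain ⟨ξ, hξ0, hξ, hb⟩ := hc₁ ι κ (Matrix.of N) A hN0 hι (by omega) (fun i j => by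
      rw [Matrix.of_apply, house_eq_norm hK σ, hN']
      exact hMA i j)
    refine ⟨fun j => σ (ξ j : K), ?_, fun j => mem_intRange σ _, ?_, fun j => ?_⟩
    · intro h
      apply hξ0
      funext j
      have h1 : σ (ξ j : K) = 0 := congrFun h j
      rw [map_eq_zero] at h1
      exact RingOfIntegers.coe_eq_zero_iff.1 h1
    · funext i
      have h1 := congrFun hξ i
      simp only [Matrix.mulVec, dotProduct, Matrix.of_apply, Pi.zero_apply] at h1 ⊢
      have h2 := congrArg (σ.comp (algebraMap (𝓞 K) K)) h1
      rw [map_sum, map_zero] at h2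
      rw [← h2]
      refine Finset.sum_congr rfl fun j _ => ?_
      rw [map_mul, ← hN']
      rfl
    · rw [← house_eq_norm hK σ]
      refine (hb j).trans ((le_abs_self _).trans ?_)
      rw [abs_mul]
      set e : ℝ := ((Fintype.card ι : ℕ) : ℝ) / ((Fintype.card κ : ℕ) - (Fintype.card ι : ℕ)) with he
      have hικ' : 2 * (Fintype.card ι : ℝ) ≤ Fintype.card κ := by exact_mod_cast hικ
      have hι' : (0 : ℝ) < Fintype.card ι := by exact_mod_cast hι
      have he0 : 0 ≤ e := div_nonneg hι'.le (by linarith)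
      -- Twice as many unknowns as equations makes the Siegel exponent at most `1`, so the bound is
      -- linear in `A`.
      have he1 : e ≤ 1 := by
        rw [he, div_le_one (by linarith)]
        linarith
      have h2 : |(c₁ * (Fintype.card κ : ℕ) * A) ^ e| ≤ c * Fintype.card κ * A := by
        refine (Real.abs_rpow_le_abs_rpow _ _).trans ?_
        have h3 : |c₁ * (Fintype.card κ : ℕ) * A| ≤ c * Fintype.card κ * A := by
          rw [abs_mul, abs_mul, Nat.abs_cast, abs_of_pos (by linarith : 0 < A)]
          gcongr
        refine (Real.rpow_le_rpow (abs_nonneg _) h3 he0).trans ?_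
        refine (Real.rpow_le_rpow_of_exponent_le hbase he1).trans ?_
        rw [Real.rpow_one]
      calc |c₁| * |(c₁ * (Fintype.card κ : ℕ) * A) ^ e| ≤ c * (c * Fintype.card κ * A) :=
            mul_le_mul hcc h2 (abs_nonneg _) (by linarith)
        _ = c * c * Fintype.card κ * A := by ring

end Integers

/-! ### Denominators and size of the coefficients of the power series solution. -/

section Coefficients

variable {F : Type*} [Field F]

/-- The coefficients of the power series solution of `P(z) f(z) = P(z) + a z^s f(z/q)`. -/
noncomputable def poincareCoeff (s : ℕ) (P : F[X]) (q a : F) (N : ℕ) : F :=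
  P.coeff N / P.coeff 0 + ∑ j : Fin N,
    ((if (j : ℕ) + s = N then a / P.coeff 0 * q⁻¹ ^ (j : ℕ) else 0) -
      P.coeff (N - j) / P.coeff 0) * poincareCoeff s P q a j
decreasing_by exact j.2

theorem poincareCoeff_eq (s : ℕ) (P : F[X]) (q a : F) (N : ℕ) :
    poincareCoeff s P q a N = P.coeff N / P.coeff 0 + ∑ j ∈ Finset.range N,
      ((if j + s = N then a / P.coeff 0 * q⁻¹ ^ j else 0) -
        P.coeff (N - j) / P.coeff 0) * poincareCoeff s P q a j := by
  rw [poincareCoeff, Finset.sum_range]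

theorem mul_mk_poincareCoeff {s : ℕ} (hs : 1 ≤ s) {P : F[X]} (hP0 : P.coeff 0 ≠ 0) (q a : F) :
    (P : PowerSeries F) * PowerSeries.mk (poincareCoeff s P q a) =
      (P : PowerSeries F) + PowerSeries.C a * PowerSeries.X ^ s *
        PowerSeries.rescale q⁻¹ (PowerSeries.mk (poincareCoeff s P q a)) := by
  ext N
  rw [mul_comm, PowerSeries.coeff_mul, Finset.Nat.sum_antidiagonal_eq_sum_range_succ
    (fun i j => PowerSeries.coeff i (PowerSeries.mk (poincareCoeff s P q a)) *
      PowerSeries.coeff j (P : PowerSeries F)), Finset.sum_range_succ, map_add, mul_assoc,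
    PowerSeries.coeff_C_mul, PowerSeries.coeff_X_pow_mul']
  simp only [PowerSeries.coeff_mk, coeff_coe, PowerSeries.coeff_rescale, Nat.sub_self]
  have h1 : poincareCoeff s P q a N * P.coeff 0 = P.coeff N + ∑ j ∈ Finset.range N,
      ((if j + s = N then a * q⁻¹ ^ j * poincareCoeff s P q a j else 0) -
        poincareCoeff s P q a j * P.coeff (N - j)) := by
    rw [poincareCoeff_eq, add_mul, div_mul_cancel₀ _ hP0, Finset.sum_mul]
    congr 1
    refine Finset.sum_congr rfl fun j _ => ?_
    split_ifs
    · field_simp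
    · field_simp
      ring
  rw [h1, Finset.sum_sub_distrib]
  have h2 : ∑ j ∈ Finset.range N, (if j + s = N then a * q⁻¹ ^ j * poincareCoeff s P q a j else 0) =
      a * if s ≤ N then q⁻¹ ^ (N - s) * poincareCoeff s P q a (N - s) else 0 := by
    split_ifs with h
    · rw [Finset.sum_eq_single (N - s)]
      · rw [if_pos (by omega)]
        ring
      · intro j _ hj
        rw [if_neg (by omega)]
      · intro h3
        simp only [Finset.mem_range] at h3
        omega
    · rw [mul_zero]
      exact Finset.sum_eq_zero fun j _ => if_neg (by omega)
  rw [h2]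
  ring

theorem choose_two_add_le {j N : ℕ} (h : j < N) : j.choose 2 + j ≤ N.choose 2 := by
  have h1 : (j + 1).choose 2 = j.choose 2 + j := by
    rw [Nat.choose_succ_succ' j 1, Nat.choose_one_right, add_comm]
  rw [← h1]
  exact Nat.choose_le_choose 2 h

/-- Denominators of the coefficients of the power series solution. -/
theorem mul_poincareCoeff_mem {O : Subring F} {s : ℕ} {P : F[X]}
    (hP0 : P.coeff 0 ≠ 0) {q a₁ b₁ a d : F} (hq : q = a₁ / b₁) (ha₁ : a₁ ∈ O) (hb₁ : b₁ ∈ O)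
    (ha₁0 : a₁ ≠ 0) (hd : d ∈ O) (hdP : ∀ j, d * (P.coeff j / P.coeff 0) ∈ O)
    (hda : d * (a / P.coeff 0) ∈ O) (N : ℕ) :
    d ^ N * a₁ ^ (N.choose 2) * poincareCoeff s P q a N ∈ O := by
  induction N using Nat.strong_induction_on with
  | _ N ih =>
    rcases Nat.eq_zero_or_pos N with rfl | hN
    · rw [poincareCoeff_eq]
      simp [div_self hP0]
    · have hda' : ∀ j < N, d * a₁ ^ (N.choose 2 - j.choose 2) *
          ((if j + s = N then a / P.coeff 0 * q⁻¹ ^ j else 0) - P.coeff (N - j) / P.coeff 0)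
            ∈ O := by
        intro j hj
        rw [mul_sub]
        refine sub_mem ?_ ?_
        · split_ifs
          -- The factor `q^{-j}` needs `a₁ ^ j`, which the growth of the binomial exponent from `j`
          -- to `N` supplies.
          · obtain ⟨e, he⟩ : ∃ e, N.choose 2 - j.choose 2 = e + j :=
              ⟨N.choose 2 - j.choose 2 - j, by have := choose_two_add_le hj; omega⟩
            have : d * a₁ ^ (N.choose 2 - j.choose 2) * (a / P.coeff 0 * q⁻¹ ^ j) =
                a₁ ^ e * (d * (a / P.coeff 0)) * b₁ ^ j := by
              rw [he, hq, inv_div, div_pow, pow_add]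
              field_simp
            rw [this]
            exact mul_mem (mul_mem (pow_mem ha₁ _) hda) (pow_mem hb₁ _)
          · rw [mul_zero]
            exact zero_mem _
        · rw [mul_right_comm]
          exact mul_mem (hdP _) (pow_mem ha₁ _)
      rw [poincareCoeff_eq, mul_add, Finset.mul_sum]
      refine add_mem ?_ (sum_mem fun j hj => ?_)
      · obtain ⟨M, rfl⟩ : ∃ M, N = M + 1 := ⟨N - 1, by omega⟩
        have : d ^ (M + 1) * a₁ ^ ((M + 1).choose 2) * (P.coeff (M + 1) / P.coeff 0) =
            d ^ M * a₁ ^ ((M + 1).choose 2) * (d * (P.coeff (M + 1) / P.coeff 0)) := by ring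
        rw [this]
        exact mul_mem (mul_mem (pow_mem hd _) (pow_mem ha₁ _)) (hdP _)
      · have hj' : j < N := Finset.mem_range.1 hj
        obtain ⟨e, he⟩ : ∃ e, N = e + 1 + j := ⟨N - 1 - j, by omega⟩
        have hc : N.choose 2 = N.choose 2 - j.choose 2 + j.choose 2 := by
          have := choose_two_add_le hj'
          omega
        have h1 : d ^ N = d ^ e * d * d ^ j := by rw [he, pow_add, pow_succ]
        have h2 : a₁ ^ N.choose 2 = a₁ ^ (N.choose 2 - j.choose 2) * a₁ ^ j.choose 2 := by
          rw [← pow_add, ← hc]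
        have h3 := mul_mem (mul_mem (pow_mem hd e) (hda' j hj')) (ih j hj')
        rw [h1, h2]
        convert h3 using 1
        ring

end Coefficients

/-- The recursion weights have norm at most `2g`; the base `1 + 4g` makes the geometric sum `2g ∑ (1
+ 4g)^j` equal to `((1 + 4g)^N - 1)/2`, leaving room for the inhomogeneous term. -/
theorem norm_poincareCoeff_le {s : ℕ} {P : ℂ[X]} (hP0 : P.coeff 0 ≠ 0) {q a : ℂ} (hq : 1 < ‖q‖)
    {g : ℝ} (hgP : ∀ j, ‖P.coeff j / P.coeff 0‖ ≤ g) (hga : ‖a / P.coeff 0‖ ≤ g) (N : ℕ) :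
    ‖poincareCoeff s P q a N‖ ≤ (1 + 4 * g) ^ N := by
  have hg0 : 0 ≤ g := (norm_nonneg _).trans hga
  have hq1 : ‖q⁻¹‖ ≤ 1 := by
    rw [norm_inv]
    exact inv_le_one_of_one_le₀ hq.le
  induction N using Nat.strong_induction_on with
  | _ N ih =>
    rcases Nat.eq_zero_or_pos N with rfl | hN
    · rw [poincareCoeff_eq]
      simp [div_self hP0]
    · rw [poincareCoeff_eq]
      have hterm : ∀ j ∈ Finset.range N, ‖((if j + s = N then a / P.coeff 0 * q⁻¹ ^ j else 0) -
          P.coeff (N - j) / P.coeff 0) * poincareCoeff s P q a j‖ ≤ 2 * g * (1 + 4 * g) ^ j := by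
        intro j hj
        rw [norm_mul]
        refine mul_le_mul ?_ (ih j (Finset.mem_range.1 hj)) (norm_nonneg _) (by positivity)
        refine (norm_sub_le _ _).trans ?_
        rw [two_mul]
        refine add_le_add ?_ (hgP _)
        split_ifs
        · rw [norm_mul, norm_pow]
          exact (mul_le_of_le_one_right (norm_nonneg _) (pow_le_one₀ (norm_nonneg _) hq1)).trans hga
        · simpa using hg0
      have hgeom : ∀ N : ℕ, ∑ j ∈ Finset.range N, 2 * g * (1 + 4 * g) ^ j =
          ((1 + 4 * g) ^ N - 1) / 2 := by
        intro N
        induction N with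
        | zero => simp
        | succ N ihN =>
          rw [Finset.sum_range_succ, ihN]
          ring
      refine (norm_add_le _ _).trans ((add_le_add (hgP N) (norm_sum_le_of_le _ hterm)).trans ?_)
      rw [hgeom]
      have : 1 + 4 * g ≤ (1 + 4 * g) ^ N := le_self_pow₀ (by linarith) hN.ne'
      linarith

/-! ### Evaluation of power series and the link with the Heine series. -/

section Values

theorem hasSum_X_mul {f : PowerSeries ℂ} {x y : ℂ}
    (h : HasSum (fun N => PowerSeries.coeff N f * x ^ N) y) :
    HasSum (fun N => PowerSeries.coeff N (PowerSeries.X * f) * x ^ N) (x * y) := by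
  rw [← hasSum_nat_add_iff' 1]
  simp only [PowerSeries.coeff_succ_X_mul, Finset.sum_range_one, PowerSeries.coeff_zero_X_mul,
    zero_mul, sub_zero]
  convert! h.mul_left x using 2
  ring

theorem hasSum_coe_mul (p : ℂ[X]) {f : PowerSeries ℂ} {x y : ℂ}
    (h : HasSum (fun N => PowerSeries.coeff N f * x ^ N) y) :
    HasSum (fun N => PowerSeries.coeff N ((p : PowerSeries ℂ) * f) * x ^ N) (p.eval x * y) := by
  have hC : ∀ (c : ℂ) (g : PowerSeries ℂ) (z : ℂ),
      HasSum (fun N => PowerSeries.coeff N g * x ^ N) z →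
      HasSum (fun N => PowerSeries.coeff N (PowerSeries.C c * g) * x ^ N) (c * z) := by
    intro c g z hg
    simp only [PowerSeries.coeff_C_mul]
    convert! hg.mul_left c using 2
    ring
  induction p using Polynomial.induction_on with
  | C c =>
    rw [coe_C, eval_C]
    exact hC c f y h
  | add p r hp hr =>
    rw [coe_add, add_mul, eval_add, add_mul]
    simp only [map_add, add_mul] at *
    exact hp.add hr
  | monomial n c ih =>
    convert! hasSum_X_mul ih using 1
    · funext N
      congr 2
      push_cast
      ring
    · simp only [eval_mul, eval_C, eval_pow, eval_X]
      ring

theorem hasSum_coe (p : ℂ[X]) (x : ℂ) :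
    HasSum (fun N => PowerSeries.coeff N (p : PowerSeries ℂ) * x ^ N) (p.eval x) := by
  have h1 : HasSum (fun N => PowerSeries.coeff N (1 : PowerSeries ℂ) * x ^ N) 1 := by
    convert! hasSum_ite_eq 0 (1 : ℂ) using 2 with N
    rw [PowerSeries.coeff_one]
    split_ifs with h
    · simp [h]
    · simp
  simpa using hasSum_coe_mul p h1

theorem norm_le_of_hasSum {h : PowerSeries ℂ} {x z : ℂ} {M B : ℝ} {e : ℕ}
    (hM : 0 ≤ M) (hB : 0 ≤ B)
    (hz : HasSum (fun N => PowerSeries.coeff N h * x ^ N) z)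
    (hb : ∀ N, ‖PowerSeries.coeff N h‖ ≤ M * B ^ N) (he : ∀ N < e, PowerSeries.coeff N h = 0)
    (hx : B * ‖x‖ ≤ 1 / 2) : ‖z‖ ≤ 2 * M * (B * ‖x‖) ^ e := by
  rw [← hasSum_nat_add_iff' e, Finset.sum_eq_zero fun N hN => by
    rw [he N (Finset.mem_range.1 hN), zero_mul], sub_zero] at hz
  have hg := (hasSum_geometric_two).mul_left (M * (B * ‖x‖) ^ e)
  have := hz.norm_le_of_bounded hg fun N => ?_
  · linarith
  · rw [norm_mul, norm_pow]
    calc ‖PowerSeries.coeff (N + e) h‖ * ‖x‖ ^ (N + e) ≤ M * B ^ (N + e) * ‖x‖ ^ (N + e) := by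
          gcongr
          exact hb _
      _ = M * (B * ‖x‖) ^ e * (B * ‖x‖) ^ N := by ring
      _ ≤ M * (B * ‖x‖) ^ e * (1 / 2) ^ N := by gcongr

theorem summable_of_norm_le {f : PowerSeries ℂ} {x : ℂ} {B : ℝ}
    (hb : ∀ N, ‖PowerSeries.coeff N f‖ ≤ B ^ N)
    (hx : B * ‖x‖ ≤ 1 / 2) : Summable (fun N => PowerSeries.coeff N f * x ^ N) := by
  refine Summable.of_norm_bounded summable_geometric_two fun N => ?_
  have hB : 0 ≤ B := by simpa using (norm_nonneg _).trans (hb 1)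
  rw [norm_mul, norm_pow]
  calc ‖PowerSeries.coeff N f‖ * ‖x‖ ^ N ≤ B ^ N * ‖x‖ ^ N := by
        gcongr
        exact hb N
    _ = (B * ‖x‖) ^ N := by ring
    _ ≤ (1 / 2) ^ N := by gcongr

variable {s : ℕ} {P : ℂ[X]} {q a : ℂ}

theorem term_zero : term s P q a 0 = 1 := by simp [term]

theorem term_succ_mul (hP : ∀ k : ℕ, P.eval (q⁻¹ ^ k) ≠ 0) (k : ℕ) :
    term s P q a (k + 1) * P.eval (q⁻¹ ^ k) = term s P q a k * a * (q⁻¹ ^ k) ^ s := by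
  rw [term_succ]
  have := hP k
  generalize P.eval (q⁻¹ ^ k) = e at this
  field_simp

/-- Evaluating the functional equation for the power series solution. -/
theorem eval_poincare_eq {f : PowerSeries ℂ}
    (hf : (P : PowerSeries ℂ) * f = (P : PowerSeries ℂ) + PowerSeries.C a * PowerSeries.X ^ s *
      PowerSeries.rescale q⁻¹ f) {x y y' : ℂ}
    (hy : HasSum (fun N => PowerSeries.coeff N f * x ^ N) y)
    (hy' : HasSum (fun N => PowerSeries.coeff N f * (q⁻¹ * x) ^ N) y') :
    P.eval x * y = P.eval x + a * x ^ s * y' := by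
  have h1 := hasSum_coe_mul P hy
  have h2 : HasSum (fun N => PowerSeries.coeff N (PowerSeries.rescale q⁻¹ f) * x ^ N) y' := by
    convert! hy' using 2 with N
    rw [PowerSeries.coeff_rescale, mul_pow]
    ring
  have h3 := (hasSum_coe P x).add (hasSum_coe_mul (C a * X ^ s) h2)
  rw [hf] at h1
  have h4 := h1.unique (by
    convert! h3 using 2 with N
    rw [map_add, add_mul]
    push_cast
    rfl)
  rw [h4]
  simp

/-- By the functional equation, `S_k + t_k f(q^{-k})` does not depend on `k ≥ k₀`, and it tends to
`φ` since `t_k → 0` while `f(q^{-k})` stays bounded. The threshold `k₀` is needed because zeros of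
`P` may keep `f` from converging at `1`. -/
theorem phi_eq_sum_add (hs : 1 ≤ s) (hq : 1 < ‖q‖) (hP0 : P.eval 0 ≠ 0)
    (hP : ∀ k : ℕ, P.eval (q⁻¹ ^ k) ≠ 0) {f : PowerSeries ℂ}
    (hf : (P : PowerSeries ℂ) * f = (P : PowerSeries ℂ) + PowerSeries.C a * PowerSeries.X ^ s *
      PowerSeries.rescale q⁻¹ f) {y : ℕ → ℂ} {k₀ : ℕ} {M : ℝ}
    (hy : ∀ k, k₀ ≤ k → HasSum (fun N => PowerSeries.coeff N f * (q⁻¹ ^ k) ^ N) (y k))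
    (hM : ∀ k, k₀ ≤ k → ‖y k‖ ≤ M) {k : ℕ} (hk : k₀ ≤ k) :
    phi s P q a = ∑ j ∈ Finset.range k, term s P q a j + term s P q a k * y k := by
  have hstep : ∀ j, k₀ ≤ j → term s P q a (j + 1) * y (j + 1) + term s P q a j =
      term s P q a j * y j := by
    intro j hj
    have h1 := eval_poincare_eq hf (hy j hj) (by
      have := hy (j + 1) (by omega)
      rwa [pow_succ'] at this)
    have h2 := term_succ_mul (s := s) (a := a) hP j
    apply mul_left_cancel₀ (hP j)
    linear_combination y (j + 1) * h2 - term s P q a j * h1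
  have hconst : ∀ j, ∑ i ∈ Finset.range k, term s P q a i + term s P q a k * y k =
      ∑ i ∈ Finset.range (k + j), term s P q a i + term s P q a (k + j) * y (k + j) := by
    intro j
    induction j with
    | zero => rfl
    | succ j ih =>
      rw [ih, ← add_assoc k j 1, Finset.sum_range_succ, ← hstep (k + j) (by omega)]
      ring
  have hsum1 := summable_term hs hq hP0 (fun k => by rw [← inv_pow]; exact hP k) a
  have hsum : Summable (fun n => term s P q a n) := (summable_nat_add_iff 1).1 hsum1
  have hphi : phi s P q a = ∑' n, term s P q a n := by
    rw [phi, hsum.tsum_eq_zero_add, term_zero]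
  have hshift := Filter.tendsto_add_atTop_nat k
  have hlim1 : Filter.Tendsto (fun j => ∑ i ∈ Finset.range (j + k), term s P q a i) Filter.atTop
      (nhds (phi s P q a)) := by
    rw [hphi]
    exact hsum.hasSum.tendsto_sum_nat.comp hshift
  have hlim2 : Filter.Tendsto (fun j => term s P q a (j + k) * y (j + k)) Filter.atTop
      (nhds 0) := by
    have h0 : Filter.Tendsto (fun j => ‖term s P q a (j + k)‖ * M) Filter.atTop (nhds 0) := by
      simpa using ((hsum.tendsto_atTop_zero.comp hshift).norm).mul_const M
    refine squeeze_zero_norm (fun j => ?_) h0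
    rw [norm_mul]
    gcongr
    exact hM _ (by omega)
  have hlim := hlim1.add hlim2
  rw [add_zero] at hlim
  refine tendsto_nhds_unique hlim ?_
  refine tendsto_const_nhds.congr fun j => ?_
  rw [hconst j, add_comm k j]

end Values

/-- Integral data for the generalized Heine series: `q = a/b`, and `d` is a common denominator of
the coefficients of the functional equations. -/
structure IntegralData (O : Subring ℂ) {m : ℕ} (s : ℕ) (P : ℂ[X]) (q a b d : ℂ) (α : Fin m → ℂ) :
    Prop where
  one_le_norm : ∀ x ∈ O, x ≠ 0 → 1 ≤ ‖x‖
  one_le_s : 1 ≤ s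
  a_mem : a ∈ O
  b_mem : b ∈ O
  d_mem : d ∈ O
  d_ne : d ≠ 0
  q_eq : q = a / b
  one_lt_norm_q : 1 < ‖q‖
  natDegree_le : P.natDegree ≤ s
  eval_zero_ne : P.eval 0 ≠ 0
  eval_ne : ∀ k : ℕ, P.eval (q⁻¹ ^ k) ≠ 0
  d_mul_coeff : ∀ j, d * P.coeff j ∈ O
  d_mul_coeff_div : ∀ j, d * (P.coeff j / P.coeff 0) ∈ O
  d_mul_α : ∀ i, d * α i ∈ O
  d_mul_α_div : ∀ i, d * (α i / P.coeff 0) ∈ O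

/-! ### Construction of the Padé-type approximations. -/

namespace IntegralData

variable {O : Subring ℂ} {m s : ℕ} {P : ℂ[X]} {q a b d : ℂ} {α : Fin m → ℂ}

theorem q_ne (h : IntegralData O s P q a b d α) : q ≠ 0 := by
  intro h0
  have := h.one_lt_norm_q
  rw [h0, norm_zero] at this
  linarith

theorem b_ne (h : IntegralData O s P q a b d α) : b ≠ 0 := fun h0 =>
  h.q_ne (by rw [h.q_eq, h0, div_zero])

theorem a_ne (h : IntegralData O s P q a b d α) : a ≠ 0 := fun h0 =>
  h.q_ne (by rw [h.q_eq, h0, zero_div])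

theorem coeff_zero_ne (h : IntegralData O s P q a b d α) : P.coeff 0 ≠ 0 := by
  rw [coeff_zero_eq_eval_zero]
  exact h.eval_zero_ne

theorem one_lt_norm_a (h : IntegralData O s P q a b d α) : 1 < ‖a‖ := by
  have h1 := h.one_lt_norm_q
  have h2 := h.one_le_norm b h.b_mem h.b_ne
  rw [h.q_eq, norm_div, lt_div_iff₀ (by linarith)] at h1
  linarith

theorem pow_mul_coeff_mem (h : IntegralData O s P q a b d α) (i : Fin m) {N N₀ : ℕ} (hN : N ≤ N₀) :
    d ^ N₀ * a ^ N₀.choose 2 * poincareCoeff s P q (α i) N ∈ O := by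
  have h1 := mul_poincareCoeff_mem (s := s) h.coeff_zero_ne h.q_eq h.a_mem h.b_mem h.a_ne h.d_mem
    h.d_mul_coeff_div (h.d_mul_α_div i) N
  obtain ⟨e, rfl⟩ := Nat.exists_eq_add_of_le hN
  obtain ⟨e', he'⟩ := Nat.exists_eq_add_of_le (Nat.choose_le_choose 2 hN)
  have h2 := mul_mem (mul_mem (pow_mem h.d_mem e) (pow_mem h.a_mem e')) h1
  rw [he']
  convert h2 using 1
  ring

/-- Padé-type approximations of the second kind to the power series solutions of the functional
equations. -/
theorem exists_pade (h : IntegralData O s P q a b d α) {c B : ℝ} (hS : SiegelBound O c)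
    (hB1 : 1 ≤ B) (hB : ∀ i N, ‖poincareCoeff s P q (α i) N‖ ≤ B ^ N)
    {n : ℕ} {v : Fin m → ℕ} (hv : 2 * ∑ i, v i ≤ n) :
    ∃ u : Fin (m + 1) → ℂ[X], u 0 ≠ 0 ∧ (∀ j, (u j).natDegree ≤ n) ∧
      (∀ j, (u 0).coeff j ∈ O) ∧
      (∀ j, ‖(u 0).coeff j‖ ≤ c * (n + 1 : ℕ) *
        (‖d‖ ^ (n + n / 2) * ‖a‖ ^ (n + n / 2).choose 2 * B ^ (n + n / 2))) ∧
      (∀ i j, d ^ n * a ^ n.choose 2 * (u (Fin.succ i)).coeff j ∈ O) ∧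
      (∀ i, PowerSeries.X ^ (n + v i) ∣ (u (Fin.succ i) : PowerSeries ℂ) -
        PowerSeries.mk (poincareCoeff s P q (α i)) * (u 0 : PowerSeries ℂ)) ∧
      ∀ i N, ‖PowerSeries.coeff N ((u (Fin.succ i) : PowerSeries ℂ) -
        PowerSeries.mk (poincareCoeff s P q (α i)) * (u 0 : PowerSeries ℂ))‖ ≤
        (n + 1 : ℕ) * (c * (n + 1 : ℕ) *
          (‖d‖ ^ (n + n / 2) * ‖a‖ ^ (n + n / 2).choose 2 * B ^ (n + n / 2))) * B ^ N := by
  classical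
  -- The largest coefficient index in the linear system: the orders run up to `n + v i`, and `v i ≤
  -- n / 2`.
  set N₀ := n + n / 2 with hN₀
  set A : ℝ := ‖d‖ ^ N₀ * ‖a‖ ^ N₀.choose 2 * B ^ N₀ with hA
  have hd1 := h.one_le_norm d h.d_mem h.d_ne
  have ha1 := h.one_lt_norm_a.le
  have hA1 : 1 ≤ A := one_le_mul_of_one_le_of_one_le
    (one_le_mul_of_one_le_of_one_le (one_le_pow₀ hd1) (one_le_pow₀ ha1)) (one_le_pow₀ hB1)
  have hvi : ∀ i, v i ≤ n / 2 := fun i => by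
    have := Finset.single_le_sum (f := v) (fun _ _ => Nat.zero_le _) (Finset.mem_univ i)
    omega
  -- The equations kill the coefficients of index `n + 1, …, n + v i` in `f_i u₀`, after a common
  -- denominator is cleared.
  let M : Matrix (Σ i : Fin m, Fin (v i)) (Fin (n + 1)) ℂ := fun x t =>
    d ^ N₀ * a ^ N₀.choose 2 * poincareCoeff s P q (α x.1) (n + 1 + x.2 - t)
  have hidx : ∀ (x : Σ i : Fin m, Fin (v i)) (t : Fin (n + 1)), n + 1 + (x.2 : ℕ) - t ≤ N₀ := by
    intro x t
    have h1 := x.2.2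
    have h2 := hvi x.1
    omega
  obtain ⟨ξ, hξ0, hξO, hξ, hξb⟩ := hS (Σ i : Fin m, Fin (v i)) (Fin (n + 1)) M A hA1
    (fun x t => h.pow_mul_coeff_mem _ (hidx x t)) (fun x t => by
      simp only [M, norm_mul, norm_pow, hA]
      gcongr
      exact (hB _ _).trans (pow_le_pow_right₀ hB1 (hidx x t))) (by simp) (by
      simp only [Fintype.card_sigma, Fintype.card_fin]
      omega)
  rw [Fintype.card_fin] at hξb
  set p : ℂ[X] := ∑ t : Fin (n + 1), monomial (t : ℕ) (ξ t) with hp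
  have hpc : ∀ t : Fin (n + 1), p.coeff t = ξ t := by
    intro t
    rw [hp, finsetSum_coeff, Finset.sum_eq_single t]
    · rw [coeff_monomial, if_pos rfl]
    · intro t' _ ht'
      rw [coeff_monomial, if_neg (fun h0 => ht' (Fin.ext h0))]
    · simp
  have hpd : p.natDegree ≤ n :=
    natDegree_sum_le_of_forall_le _ _ fun t _ =>
      (natDegree_monomial_le _).trans (Nat.lt_succ_iff.1 t.2)
  have hpc' : ∀ j, n < j → p.coeff j = 0 := fun j hj =>
    coeff_eq_zero_of_natDegree_lt (lt_of_le_of_lt hpd hj)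
  have hpO : ∀ j, p.coeff j ∈ O := fun j => by
    rcases lt_or_ge n j with hj | hj
    · rw [hpc' j hj]
      exact zero_mem _
    · rw [hpc ⟨j, Nat.lt_succ_of_le hj⟩]
      exact hξO _
  set C₁ : ℝ := c * (n + 1 : ℕ) * A with hC₁
  have hC₁0 : 0 ≤ C₁ := (norm_nonneg _).trans (hξb 0)
  have hpb : ∀ j, ‖p.coeff j‖ ≤ C₁ := fun j => by
    rcases lt_or_ge n j with hj | hj
    · rw [hpc' j hj, norm_zero]
      exact hC₁0
    · rw [hpc ⟨j, Nat.lt_succ_of_le hj⟩]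
      exact hξb _
  have hp0 : p ≠ 0 := by
    intro h0
    apply hξ0
    funext t
    rw [← hpc, h0]
    simp
  let f : Fin m → PowerSeries ℂ := fun i => PowerSeries.mk (poincareCoeff s P q (α i))
  have hcoeff : ∀ i N, PowerSeries.coeff N (f i * (p : PowerSeries ℂ)) =
      ∑ t ∈ Finset.range (N + 1), p.coeff t * poincareCoeff s P q (α i) (N - t) := by
    intro i N
    rw [mul_comm, PowerSeries.coeff_mul, Finset.Nat.sum_antidiagonal_eq_sum_range_succ
      (fun i₁ j => PowerSeries.coeff i₁ (p : PowerSeries ℂ) * PowerSeries.coeff j (f i))]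
    simp only [f, PowerSeries.coeff_mk, coeff_coe]
  have hcoeff' : ∀ i N, n ≤ N → PowerSeries.coeff N (f i * (p : PowerSeries ℂ)) =
      ∑ t : Fin (n + 1), ξ t * poincareCoeff s P q (α i) (N - t) := by
    intro i N hN
    rw [hcoeff, ← Finset.sum_subset (Finset.range_mono (Nat.succ_le_succ hN)), Finset.sum_range]
    · exact Finset.sum_congr rfl fun t _ => by rw [hpc]
    · intro t _ ht
      rw [hpc' t (by simpa using ht), zero_mul]
  let u : Fin (m + 1) → ℂ[X] := Fin.cons p fun i => PowerSeries.trunc (n + 1) (f i * (p : PowerSeries ℂ))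
  have hus : ∀ i, u (Fin.succ i) = PowerSeries.trunc (n + 1) (f i * (p : PowerSeries ℂ)) :=
    fun _ => rfl
  have hrem : ∀ i N, PowerSeries.coeff N ((u (Fin.succ i) : PowerSeries ℂ) -
      f i * (u 0 : PowerSeries ℂ)) = if N < n + 1 then 0 else
        -PowerSeries.coeff N (f i * (p : PowerSeries ℂ)) := by
    intro i N
    rw [map_sub, coeff_coe, hus, PowerSeries.coeff_trunc]
    change _ - PowerSeries.coeff N (f i * (p : PowerSeries ℂ)) = _
    split_ifs
    · rw [sub_self]
    · rw [zero_sub]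
  refine ⟨u, hp0, ?_, hpO, hpb, ?_, ?_, ?_⟩
  · intro j
    refine Fin.cases hpd (fun i => ?_) j
    exact Nat.lt_succ_iff.1 (PowerSeries.natDegree_trunc_lt _ _)
  · intro i j
    rw [hus, PowerSeries.coeff_trunc]
    split_ifs with hj
    · rw [hcoeff, Finset.mul_sum]
      refine sum_mem fun t _ => ?_
      have h1 := mul_mem (hpO t) (h.pow_mul_coeff_mem i (show j - t ≤ n by omega))
      convert h1 using 1
      ring
    · rw [mul_zero]
      exact zero_mem _
  · intro i
    rw [PowerSeries.X_pow_dvd_iff]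
    intro N hN
    change PowerSeries.coeff N ((u (Fin.succ i) : PowerSeries ℂ) - f i * (u 0 : PowerSeries ℂ)) = 0
    rw [hrem]
    split_ifs with h1
    · rfl
    · rw [neg_eq_zero, hcoeff' i N (by omega)]
      have h2 := congrFun hξ ⟨i, ⟨N - (n + 1), by omega⟩⟩
      simp only [Matrix.mulVec, dotProduct, M, Pi.zero_apply] at h2
      rw [show n + 1 + (N - (n + 1)) = N by omega] at h2
      have h3 : d ^ N₀ * a ^ N₀.choose 2 ≠ 0 :=
        mul_ne_zero (pow_ne_zero _ h.d_ne) (pow_ne_zero _ h.a_ne)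
      apply mul_left_cancel₀ h3
      rw [mul_zero, ← h2, Finset.mul_sum]
      exact Finset.sum_congr rfl fun t _ => by ring
  · intro i N
    change ‖PowerSeries.coeff N ((u (Fin.succ i) : PowerSeries ℂ) -
      f i * (u 0 : PowerSeries ℂ))‖ ≤ _
    rw [hrem]
    have hB0 : 0 ≤ B := by linarith
    split_ifs with h1
    · rw [norm_zero]
      positivity
    · rw [norm_neg, hcoeff' i N (by omega)]
      have h2 : ∀ t ∈ (Finset.univ : Finset (Fin (n + 1))),
          ‖ξ t * poincareCoeff s P q (α i) (N - t)‖ ≤ C₁ * B ^ N := by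
        intro t _
        rw [norm_mul]
        gcongr
        · exact hξb t
        · exact (hB _ _).trans (pow_le_pow_right₀ hB1 (Nat.sub_le _ _))
      refine (norm_sum_le_of_le _ h2).trans ?_
      rw [Finset.sum_const, Finset.card_univ, Fintype.card_fin, nsmul_eq_mul, ← mul_assoc]

end IntegralData

/-! ### Common denominators, size and quality of the approximations. -/

namespace IntegralData

variable {O : Subring ℂ} {m s : ℕ} {P : ℂ[X]} {q a b d : ℂ} {α : Fin m → ℂ}

theorem pow_mul_eval_mem (h : IntegralData O s P q a b d α) {p : ℂ[X]} {n : ℕ}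
    (hp : p.natDegree ≤ n) (hpO : ∀ j, p.coeff j ∈ O) (k : ℕ) :
    a ^ (n * k) * p.eval (q⁻¹ ^ k) ∈ O := by
  rw [eval_eq_sum_range' (Nat.lt_succ_of_le hp), Finset.mul_sum]
  refine sum_mem fun j hj => ?_
  obtain ⟨e, rfl⟩ := Nat.exists_eq_add_of_le (Nat.lt_succ_iff.1 (Finset.mem_range.1 hj))
  have ha := h.a_ne
  have h1 : a ^ ((j + e) * k) * (p.coeff j * (q⁻¹ ^ k) ^ j) =
      p.coeff j * a ^ (e * k) * b ^ (k * j) := by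
    have h2 : (a ^ (j * k)) * (q⁻¹ ^ k) ^ j = b ^ (k * j) := by
      rw [h.q_eq, inv_div, ← pow_mul, div_pow, mul_comm j k, mul_div_cancel₀ _ (pow_ne_zero _ ha)]
    rw [add_mul, pow_add]
    linear_combination a ^ (e * k) * p.coeff j * h2
  rw [h1]
  exact mul_mem (mul_mem (hpO j) (pow_mem h.a_mem _)) (pow_mem h.b_mem _)

/-- The common denominator of the first `k` partial sums of the Heine series. -/
noncomputable def partialDenom (s : ℕ) (P : ℂ[X]) (q a d : ℂ) (k : ℕ) : ℂ :=
  ∏ l ∈ Finset.range k, (a ^ (s * l) * (d * P.eval (q⁻¹ ^ l)))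

theorem factor_mem (h : IntegralData O s P q a b d α) (l : ℕ) :
    a ^ (s * l) * (d * P.eval (q⁻¹ ^ l)) ∈ O := by
  have := h.pow_mul_eval_mem (p := C d * P) ((natDegree_C_mul_le _ _).trans h.natDegree_le)
    (fun j => by rw [coeff_C_mul]; exact h.d_mul_coeff j) l
  rwa [eval_mul, eval_C] at this

theorem partialDenom_mem (h : IntegralData O s P q a b d α) (k : ℕ) :
    partialDenom s P q a d k ∈ O :=
  prod_mem fun l _ => h.factor_mem l

/-- The powers of `a` cancel against `q^{-sl}` and only powers of `b` remain. Hence the remainder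
carries `γ s k²/2` where the full denominator costs `s k²/2`. -/
theorem partialDenom_mul_term (h : IntegralData O s P q a b d α) (i : Fin m) (k : ℕ) :
    partialDenom s P q a d k * term s P q (α i) k =
      ∏ l ∈ Finset.range k, (d * α i * b ^ (s * l)) := by
  induction k with
  | zero => simp [partialDenom, term_zero]
  | succ k ih =>
    have h1 := term_succ_mul (s := s) (a := α i) h.eval_ne k
    have h2 : a ^ (s * k) * (q⁻¹ ^ k) ^ s = b ^ (s * k) := by
      rw [h.q_eq, inv_div, ← pow_mul, div_pow, mul_comm k s,
        mul_div_cancel₀ _ (pow_ne_zero _ h.a_ne)]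
    rw [Finset.prod_range_succ, ← ih, partialDenom, Finset.prod_range_succ]
    change partialDenom s P q a d k * _ * _ = _
    linear_combination (partialDenom s P q a d k * a ^ (s * k) * d) * h1 +
      partialDenom s P q a d k * d * term s P q (α i) k * α i * h2

theorem partialDenom_mul_term_mem (h : IntegralData O s P q a b d α) (i : Fin m) {j k : ℕ}
    (hjk : j ≤ k) : partialDenom s P q a d k * term s P q (α i) j ∈ O := by
  induction k, hjk using Nat.le_induction with
  | base =>
    rw [h.partialDenom_mul_term]
    exact prod_mem fun l _ => mul_mem (h.d_mul_α i) (pow_mem h.b_mem _)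
  | succ k _ ih =>
    have h1 := mul_mem ih (h.factor_mem k)
    rw [partialDenom, Finset.prod_range_succ]
    convert h1 using 1
    rw [partialDenom]
    ring

theorem norm_inv_pow_le_one (h : IntegralData O s P q a b d α) (k : ℕ) : ‖q⁻¹ ^ k‖ ≤ 1 := by
  rw [norm_pow, norm_inv]
  exact pow_le_one₀ (by positivity) (inv_le_one_of_one_le₀ h.one_lt_norm_q.le)

theorem norm_eval_le {p : ℂ[X]} {n : ℕ} (hp : p.natDegree ≤ n) {C₁ : ℝ}
    (hC : ∀ j, ‖p.coeff j‖ ≤ C₁) {x : ℂ} (hx : ‖x‖ ≤ 1) : ‖p.eval x‖ ≤ (n + 1 : ℕ) * C₁ := by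
  rw [eval_eq_sum_range' (Nat.lt_succ_of_le hp)]
  refine (norm_sum_le _ _).trans ((Finset.sum_le_card_nsmul _ _ C₁ fun j _ => ?_).trans ?_)
  · rw [norm_mul, norm_pow]
    exact (mul_le_of_le_one_right (norm_nonneg _) (pow_le_one₀ (norm_nonneg _) hx)).trans (hC j)
  · rw [Finset.card_range, nsmul_eq_mul]

theorem sum_range_mul_le (s k : ℕ) (L : ℝ) (hL : 0 ≤ L) :
    ∑ l ∈ Finset.range k, L * ((s * l : ℕ) : ℝ) ≤ L * (s * k ^ 2 / 2) := by
  induction k with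
  | zero => simp
  | succ k ih =>
    rw [Finset.sum_range_succ]
    push_cast at ih ⊢
    have : 0 ≤ L * s := by positivity
    nlinarith

theorem choose_two_le (n : ℕ) : ((n.choose 2 : ℕ) : ℝ) ≤ n ^ 2 / 2 := by
  rw [Nat.cast_choose_two]
  have : (0 : ℝ) ≤ n := Nat.cast_nonneg n
  nlinarith

theorem norm_prod_range_le {g : ℕ → ℂ} {w : ℂ} {Λ L : ℝ} (hL : 0 ≤ L) (hw : ‖w‖ = Real.exp L)
    (hg : ∀ l, ‖g l‖ ≤ Real.exp Λ) (k : ℕ) :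
    ‖∏ l ∈ Finset.range k, (w ^ (s * l) * g l)‖ ≤ Real.exp (Λ * k + L * (s * k ^ 2 / 2)) := by
  rw [norm_prod]
  have h1 : ∀ l ∈ Finset.range k, ‖w ^ (s * l) * g l‖ ≤ Real.exp (Λ + L * ((s * l : ℕ) : ℝ)) := by
    intro l _
    rw [norm_mul, norm_pow, hw, ← Real.exp_nat_mul, Real.exp_add, mul_comm, mul_comm L]
    gcongr
    exact hg l
  refine (Finset.prod_le_prod (fun _ _ => norm_nonneg _) h1).trans ?_
  rw [← Real.exp_sum, Finset.sum_add_distrib, Finset.sum_const, Finset.card_range, nsmul_eq_mul,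
    mul_comm Λ]
  gcongr
  exact sum_range_mul_le s k L hL

set_option maxHeartbeats 1000000 in
/-- Bounds for the size of the integral approximations and for their quality. -/
theorem approximation_bounds (h : IntegralData O s P q a b d α) {L γ Λ c B : ℝ}
    (hL : 0 < L) (ha : ‖a‖ = Real.exp L) (hb : ‖b‖ = Real.exp (γ * L)) (hγ : 0 ≤ γ) (hΛ : 1 ≤ Λ)
    (hB1 : 1 ≤ B) (hB : ∀ i N, ‖poincareCoeff s P q (α i) N‖ ≤ B ^ N)
    (hc1 : 1 ≤ c) (hcΛ : c ≤ Real.exp Λ) (hBΛ : B ≤ Real.exp Λ) (hdΛ : ‖d‖ ≤ Real.exp Λ)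
    (hPΛ : ∀ l : ℕ, ‖d * P.eval (q⁻¹ ^ l)‖ ≤ Real.exp Λ) (hαΛ : ∀ i, ‖d * α i‖ ≤ Real.exp Λ)
    {k₀ : ℕ} (hk₀ : ∀ k, k₀ ≤ k → B * ‖q⁻¹ ^ k‖ ≤ 1 / 2)
    {n : ℕ} (hn : 1 ≤ n) {v : Fin m → ℕ} (hv : 2 * ∑ i, v i ≤ n) {u : Fin (m + 1) → ℂ[X]}
    (hud : ∀ j, (u j).natDegree ≤ n) (huO : ∀ j, (u 0).coeff j ∈ O)
    (hub : ∀ j, ‖(u 0).coeff j‖ ≤ c * (n + 1 : ℕ) *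
        (‖d‖ ^ (n + n / 2) * ‖a‖ ^ (n + n / 2).choose 2 * B ^ (n + n / 2)))
    (huO' : ∀ i j, d ^ n * a ^ n.choose 2 * (u (Fin.succ i)).coeff j ∈ O)
    (hX : ∀ i, PowerSeries.X ^ (n + v i) ∣ (u (Fin.succ i) : PowerSeries ℂ) -
        PowerSeries.mk (poincareCoeff s P q (α i)) * (u 0 : PowerSeries ℂ))
    (hr : ∀ i N, ‖PowerSeries.coeff N ((u (Fin.succ i) : PowerSeries ℂ) -
        PowerSeries.mk (poincareCoeff s P q (α i)) * (u 0 : PowerSeries ℂ))‖ ≤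
        (n + 1 : ℕ) * (c * (n + 1 : ℕ) *
          (‖d‖ ^ (n + n / 2) * ‖a‖ ^ (n + n / 2).choose 2 * B ^ (n + n / 2))) * B ^ N)
    {k : ℕ} (hk : k₀ ≤ k) :
    ∃ w : ℂ, w ≠ 0 ∧ w * (u 0).eval (q⁻¹ ^ k) ∈ O ∧
      (∀ i, w * ((∑ j ∈ Finset.range k, term s P q (α i) j) * (u 0).eval (q⁻¹ ^ k) +
        term s P q (α i) k * (u (Fin.succ i)).eval (q⁻¹ ^ k)) ∈ O) ∧
      ‖w * (u 0).eval (q⁻¹ ^ k)‖ ≤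
        Real.exp (L * (s * k ^ 2 / 2 + n * k + 13 / 8 * n ^ 2) + 10 * Λ * (k + n)) ∧
      ∀ i, ‖w * (u 0).eval (q⁻¹ ^ k) * phi s P q (α i) -
        w * ((∑ j ∈ Finset.range k, term s P q (α i) j) * (u 0).eval (q⁻¹ ^ k) +
        term s P q (α i) k * (u (Fin.succ i)).eval (q⁻¹ ^ k))‖ ≤
        Real.exp (L * (γ * s * k ^ 2 / 2 + n * k + 13 / 8 * n ^ 2 - (1 - γ) * k * (n + v i)) +
          10 * Λ * (k + n)) := by
  set x := q⁻¹ ^ k with hx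
  set Q := u 0 with hQ
  set W := partialDenom s P q a d k with hW
  set E := d ^ n * a ^ n.choose 2 with hE
  -- `W` clears the partial sums, `E` the coefficients of the `u_i`, and `a ^ (n * k)` the powers of
  -- `q⁻¹ ^ k` up to degree `n`.
  set w := W * E * a ^ (n * k) with hw
  set C₁ : ℝ := c * (n + 1 : ℕ) *
    (‖d‖ ^ (n + n / 2) * ‖a‖ ^ (n + n / 2).choose 2 * B ^ (n + n / 2)) with hC₁
  have hEO : E ∈ O := mul_mem (pow_mem h.d_mem _) (pow_mem h.a_mem _)
  have hWO : W ∈ O := h.partialDenom_mem k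
  have hQO := h.pow_mul_eval_mem (hud 0) huO k
  have hx1 : ‖x‖ ≤ 1 := h.norm_inv_pow_le_one k
  have hn1 : (1 : ℝ) ≤ n := by exact_mod_cast hn
  have hk0 : (0 : ℝ) ≤ k := Nat.cast_nonneg k
  have hΛn : (n : ℝ) ≤ Λ * n := le_mul_of_one_le_left (by linarith) hΛ
  have hΛ1 : Λ ≤ Λ * n := le_mul_of_one_le_right (by linarith) hn1
  have hne : ((n + 1 : ℕ) : ℝ) ≤ Real.exp n := by
    push_cast
    exact Real.add_one_le_exp _
  have hW_le : ‖W‖ ≤ Real.exp (Λ * k + L * (s * k ^ 2 / 2)) :=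
    norm_prod_range_le hL.le ha hPΛ k
  have hE_le : ‖E‖ ≤ Real.exp (Λ * n + L * (n ^ 2 / 2)) := by
    rw [hE, norm_mul, norm_pow, norm_pow, ha, Real.exp_add, ← Real.exp_nat_mul L, mul_comm _ L]
    gcongr
    · rw [mul_comm, Real.exp_nat_mul]
      gcongr
    · exact choose_two_le n
  have ha_le : ‖a ^ (n * k)‖ = Real.exp (L * (n * k)) := by
    rw [norm_pow, ha, ← Real.exp_nat_mul]
    push_cast
    ring_nf
  -- The `9/8` is `(3/2)² / 2`, from the binomial of `n + n / 2`; with the `1/2` coming from `E` it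
  -- makes the `13/8` of the final bounds.
  have hC₁_le : C₁ ≤ Real.exp (4 * Λ * n + n + L * (9 / 8 * n ^ 2)) := by
    have hN : ((n + n / 2 : ℕ) : ℝ) ≤ 3 / 2 * n := by
      have h1 : 2 * (n + n / 2) ≤ 3 * n := by omega
      have h2 : (2 : ℝ) * ((n + n / 2 : ℕ) : ℝ) ≤ 3 * n := by exact_mod_cast h1
      linarith
    have h1 : ‖d‖ ^ (n + n / 2) ≤ Real.exp (Λ * (3 / 2 * n)) := by
      refine (pow_le_pow_left₀ (norm_nonneg _) hdΛ _).trans ?_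
      rw [← Real.exp_nat_mul, mul_comm]
      gcongr
    have h2 : B ^ (n + n / 2) ≤ Real.exp (Λ * (3 / 2 * n)) := by
      refine (pow_le_pow_left₀ (by linarith) hBΛ _).trans ?_
      rw [← Real.exp_nat_mul, mul_comm]
      gcongr
    have h3 : ‖a‖ ^ (n + n / 2).choose 2 ≤ Real.exp (L * (9 / 8 * n ^ 2)) := by
      rw [ha, ← Real.exp_nat_mul, mul_comm]
      gcongr
      refine (choose_two_le _).trans ?_
      have : (0 : ℝ) ≤ ((n + n / 2 : ℕ) : ℝ) := Nat.cast_nonneg _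
      nlinarith
    calc C₁ ≤ Real.exp Λ * Real.exp n * (Real.exp (Λ * (3 / 2 * n)) *
          Real.exp (L * (9 / 8 * n ^ 2)) * Real.exp (Λ * (3 / 2 * n))) := by
          rw [hC₁]
          gcongr
      _ = Real.exp (Λ + n + (Λ * (3 / 2 * n) + L * (9 / 8 * n ^ 2) + Λ * (3 / 2 * n))) := by
          simp only [Real.exp_add]
      _ ≤ _ := by
          apply Real.exp_le_exp.2
          linarith
  have hΛk : 0 ≤ Λ * k := by positivity
  refine ⟨w, ?_, ?_, fun i => ?_, ?_, fun i => ?_⟩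
  · refine mul_ne_zero (mul_ne_zero ?_ ?_) (pow_ne_zero _ h.a_ne)
    · exact Finset.prod_ne_zero_iff.2 fun l _ =>
        mul_ne_zero (pow_ne_zero _ h.a_ne) (mul_ne_zero h.d_ne (h.eval_ne l))
    · exact mul_ne_zero (pow_ne_zero _ h.d_ne) (pow_ne_zero _ h.a_ne)
  · have h1 := mul_mem (mul_mem hWO hEO) hQO
    convert h1 using 1
    rw [hw]
    ring
  · have h1 : W * ∑ j ∈ Finset.range k, term s P q (α i) j ∈ O := by
      rw [Finset.mul_sum]
      exact sum_mem fun j hj => h.partialDenom_mul_term_mem i (Finset.mem_range.1 hj).le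
    have h2 : W * term s P q (α i) k ∈ O := h.partialDenom_mul_term_mem i le_rfl
    have h3 := h.pow_mul_eval_mem (p := C E * u (Fin.succ i))
      ((natDegree_C_mul_le _ _).trans (hud _))
      (fun j => by rw [coeff_C_mul]; exact huO' i j) k
    rw [eval_mul, eval_C] at h3
    have h4 := add_mem (mul_mem (mul_mem h1 hEO) hQO) (mul_mem h2 h3)
    convert h4 using 1
    rw [hw]
    ring
  · have h1 : ‖Q.eval x‖ ≤ Real.exp n * Real.exp (4 * Λ * n + n + L * (9 / 8 * n ^ 2)) :=
      (norm_eval_le (hud 0) hub hx1).trans (by gcongr)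
    calc ‖w * Q.eval x‖ = ‖W‖ * ‖E‖ * ‖a ^ (n * k)‖ * ‖Q.eval x‖ := by
          rw [hw, norm_mul, norm_mul, norm_mul]
      _ ≤ Real.exp (Λ * k + L * (s * k ^ 2 / 2)) * Real.exp (Λ * n + L * (n ^ 2 / 2)) *
          Real.exp (L * (n * k)) *
          (Real.exp n * Real.exp (4 * Λ * n + n + L * (9 / 8 * n ^ 2))) := by
          rw [ha_le]
          gcongr
      _ = Real.exp ((Λ * k + L * (s * k ^ 2 / 2)) + (Λ * n + L * (n ^ 2 / 2)) + L * (n * k) +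
          (n + (4 * Λ * n + n + L * (9 / 8 * n ^ 2)))) := by simp only [Real.exp_add]
      _ ≤ _ := by
          apply Real.exp_le_exp.2
          linarith
  · set f := PowerSeries.mk (poincareCoeff s P q (α i)) with hf
    have hfB : ∀ N, ‖PowerSeries.coeff N f‖ ≤ B ^ N := fun N => by
      rw [hf, PowerSeries.coeff_mk]
      exact hB i N
    have hfeq := mul_mk_poincareCoeff h.one_le_s h.coeff_zero_ne q (α i)
    have hy : ∀ k, k₀ ≤ k → HasSum (fun N => PowerSeries.coeff N f * (q⁻¹ ^ k) ^ N)
        (∑' N, PowerSeries.coeff N f * (q⁻¹ ^ k) ^ N) := fun k hk =>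
      (summable_of_norm_le hfB (hk₀ k hk)).hasSum
    set y : ℕ → ℂ := fun k => ∑' N, PowerSeries.coeff N f * (q⁻¹ ^ k) ^ N with hyd
    have hyM : ∀ k, k₀ ≤ k → ‖y k‖ ≤ 2 := fun k hk => by
      have := norm_le_of_hasSum (M := 1) (e := 0) zero_le_one (by linarith) (hy k hk)
        (fun N => by rw [one_mul]; exact hfB N) (fun N hN => absurd hN (Nat.not_lt_zero _))
        (hk₀ k hk)
      simpa only [pow_zero, mul_one] using this
    have hphi := phi_eq_sum_add h.one_le_s h.one_lt_norm_q h.eval_zero_ne h.eval_ne hfeq hy hyM hk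
    set R := (u (Fin.succ i)).eval x - Q.eval x * y k with hR
    have hRsum : HasSum (fun N => PowerSeries.coeff N ((u (Fin.succ i) : PowerSeries ℂ) -
        f * (Q : PowerSeries ℂ)) * x ^ N) R := by
      have h1 := (hasSum_coe (u (Fin.succ i)) x).sub (hasSum_coe_mul Q (hy k hk))
      convert! h1 using 2 with N
      rw [mul_comm f, map_sub, sub_mul]
    have hR_le : ‖R‖ ≤ 2 * ((n + 1 : ℕ) * C₁) * (B * ‖x‖) ^ (n + v i) := by
      have hC₁0 : 0 ≤ C₁ := (norm_nonneg _).trans (hub 0)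
      exact norm_le_of_hasSum (by positivity) (by linarith) hRsum (hr i)
        (PowerSeries.X_pow_dvd_iff.1 (hX i)) (hk₀ k hk)
    have hid : w * Q.eval x * phi s P q (α i) -
        w * ((∑ j ∈ Finset.range k, term s P q (α i) j) * Q.eval x +
        term s P q (α i) k * (u (Fin.succ i)).eval x) =
        -((W * term s P q (α i) k) * E * a ^ (n * k) * R) := by
      rw [hphi, hR, hw]
      ring
    have hWt : ‖W * term s P q (α i) k‖ ≤ Real.exp (Λ * k + γ * L * (s * k ^ 2 / 2)) := by
      rw [h.partialDenom_mul_term]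
      simp only [mul_comm (d * α i)]
      exact norm_prod_range_le (by positivity) hb (fun _ => hαΛ i) k
    have hvi : (v i : ℝ) ≤ n := by
      have := Finset.single_le_sum (f := v) (fun _ _ => Nat.zero_le _) (Finset.mem_univ i)
      exact_mod_cast (by omega : v i ≤ n)
    have hxe : ‖x‖ = Real.exp (-((1 - γ) * L * k)) := by
      rw [hx, norm_pow, norm_inv, h.q_eq, norm_div, ha, hb, ← Real.exp_sub, ← Real.exp_neg,
        ← Real.exp_nat_mul]
      ring_nf
    have hBx : (B * ‖x‖) ^ (n + v i) ≤
        Real.exp (2 * Λ * n - (1 - γ) * L * k * (n + v i)) := by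
      rw [hxe]
      calc (B * Real.exp (-((1 - γ) * L * k))) ^ (n + v i) ≤
            (Real.exp Λ * Real.exp (-((1 - γ) * L * k))) ^ (n + v i) := by gcongr
        _ = Real.exp ((n + v i : ℕ) * (Λ + -((1 - γ) * L * k))) := by
            rw [← Real.exp_add, ← Real.exp_nat_mul]
        _ ≤ _ := by
            apply Real.exp_le_exp.2
            have h1 : Λ * v i ≤ Λ * n := by gcongr
            push_cast
            linarith
    have h2e : (2 : ℝ) ≤ Real.exp 1 := by
      have := Real.add_one_le_exp (1 : ℝ)
      linarith
    rw [hid, norm_neg]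
    calc ‖W * term s P q (α i) k * E * a ^ (n * k) * R‖ =
          ‖W * term s P q (α i) k‖ * ‖E‖ * ‖a ^ (n * k)‖ * ‖R‖ := by
          rw [norm_mul, norm_mul, norm_mul]
      _ ≤ Real.exp (Λ * k + γ * L * (s * k ^ 2 / 2)) * Real.exp (Λ * n + L * (n ^ 2 / 2)) *
          Real.exp (L * (n * k)) *
          (Real.exp 1 * (Real.exp n * Real.exp (4 * Λ * n + n + L * (9 / 8 * n ^ 2))) *
            Real.exp (2 * Λ * n - (1 - γ) * L * k * (n + v i))) := by
          rw [ha_le]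
          gcongr
          refine hR_le.trans ?_
          gcongr
      _ = Real.exp ((Λ * k + γ * L * (s * k ^ 2 / 2)) + (Λ * n + L * (n ^ 2 / 2)) + L * (n * k) +
          (1 + (n + (4 * Λ * n + n + L * (9 / 8 * n ^ 2))) +
            (2 * Λ * n - (1 - γ) * L * k * (n + v i)))) := by simp only [Real.exp_add]
      _ ≤ _ := by
          apply Real.exp_le_exp.2
          linarith

end IntegralData

theorem exists_norm_coeff_le (p : ℂ[X]) : ∃ C₁ : ℝ, ∀ j, ‖p.coeff j‖ ≤ C₁ := by
  refine ⟨∑ j ∈ Finset.range (p.natDegree + 1), ‖p.coeff j‖, fun j => ?_⟩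
  rcases lt_or_ge p.natDegree j with hj | hj
  · rw [coeff_eq_zero_of_natDegree_lt hj, norm_zero]
    positivity
  · exact Finset.single_le_sum (f := fun j => ‖p.coeff j‖) (fun _ _ => norm_nonneg _)
      (Finset.mem_range.2 (Nat.lt_succ_of_le hj))

/-! ### Choice of constants and assembly of the approximations. -/

namespace IntegralData

variable {O : Subring ℂ} {m s : ℕ} {P : ℂ[X]} {q a b d : ℂ} {α : Fin m → ℂ}

theorem exists_norm_poincareCoeff_le (h : IntegralData O s P q a b d α) :
    ∃ B : ℝ, 1 ≤ B ∧ ∀ i N, ‖poincareCoeff s P q (α i) N‖ ≤ B ^ N := by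
  obtain ⟨C₁, hC₁⟩ := exists_norm_coeff_le P
  have hC₁0 : 0 ≤ C₁ := (norm_nonneg _).trans (hC₁ 0)
  set A := ∑ i, ‖α i / P.coeff 0‖ with hA
  have hA0 : 0 ≤ A := Finset.sum_nonneg fun _ _ => norm_nonneg _
  have hg0 : 0 ≤ C₁ / ‖P.coeff 0‖ := by positivity
  refine ⟨1 + 4 * (C₁ / ‖P.coeff 0‖ + A), by linarith, fun i N => ?_⟩
  refine norm_poincareCoeff_le h.coeff_zero_ne h.one_lt_norm_q (fun j => ?_) ?_ N
  · rw [norm_div]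
    have : ‖P.coeff j‖ / ‖P.coeff 0‖ ≤ C₁ / ‖P.coeff 0‖ := by
      gcongr
      exact hC₁ j
    linarith
  · have := Finset.single_le_sum (f := fun i => ‖α i / P.coeff 0‖) (fun _ _ => norm_nonneg _)
      (Finset.mem_univ i)
    linarith

/-- Good integral simultaneous approximations to the values of the Heine series that do not
annihilate a given vector. -/
theorem exists_approximations (h : IntegralData O s P q a b d α) {c : ℝ} (hc1 : 1 ≤ c)
    (hS : SiegelBound O c) (hα0 : ∀ i, α i ≠ 0)
    (hαq : ∀ i j, i ≠ j → ∀ l : ℤ, α i ≠ α j * q ^ l)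
    (hαP : P.natDegree < s ∨
      (P.natDegree = s ∧ ∀ i, ∀ n : ℕ, 1 ≤ n → α i ≠ P.leadingCoeff * q ^ n))
    {L γ : ℝ} (hL : 0 < L) (ha : ‖a‖ = Real.exp L) (hb : ‖b‖ = Real.exp (γ * L)) (hγ : 0 ≤ γ) :
    ∃ (Λ : ℝ) (k₀ : ℕ), 0 ≤ Λ ∧ ∀ (n : ℕ) (v : Fin m → ℕ) (l₀ : ℂ) (l : Fin m → ℂ) (k₁ : ℕ),
      1 ≤ n → 2 * ∑ i, v i ≤ n → ¬ (l₀ = 0 ∧ ∀ i, l i = 0) → k₀ ≤ k₁ →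
      ∃ k, k₁ ≤ k ∧ k + ∑ i, v i ≤ k₁ + n + ((m + 1) * (m * s) + m) ∧
        ∃ X ∈ O, ∃ Y : Fin m → ℂ, (∀ i, Y i ∈ O) ∧ l₀ * X + ∑ i, l i * Y i ≠ 0 ∧
        ‖X‖ ≤ Real.exp (L * (s * k ^ 2 / 2 + n * k + 13 / 8 * n ^ 2) + Λ * (k + n)) ∧
        ∀ i, ‖X * phi s P q (α i) - Y i‖ ≤
          Real.exp (L * (γ * s * k ^ 2 / 2 + n * k + 13 / 8 * n ^ 2 - (1 - γ) * k * (n + v i)) +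
            Λ * (k + n)) := by
  obtain ⟨B, hB1, hB⟩ := h.exists_norm_poincareCoeff_le
  obtain ⟨C₁, hC₁⟩ := exists_norm_coeff_le P
  have hC₁0 : 0 ≤ C₁ := (norm_nonneg _).trans (hC₁ 0)
  set T := ‖d‖ * ((s + 1 : ℕ) * C₁) with hT
  set A := ∑ i, ‖d * α i‖ with hA
  have hT0 : 0 ≤ T := by positivity
  have hA0 : 0 ≤ A := Finset.sum_nonneg fun _ _ => norm_nonneg _
  have hd0 := norm_nonneg d
  -- A crude sum dominating every constant; `Λ ≤ exp Λ` then supplies all the exponential bounds at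
  -- once.
  set Λ := c + B + ‖d‖ + T + A with hΛ
  have hexp : Λ ≤ Real.exp Λ := by linarith [Real.add_one_le_exp Λ]
  have hq1 : ∀ n : ℕ, 1 ≤ n → q ^ n ≠ 1 := fun n hn h0 => by
    have h1 := one_lt_pow₀ h.one_lt_norm_q (by omega : n ≠ 0)
    rw [← norm_pow, h0, norm_one] at h1
    exact lt_irrefl _ h1
  obtain ⟨k₀, hk₀⟩ : ∃ k₀ : ℕ, ∀ k, k₀ ≤ k → B * ‖q⁻¹ ^ k‖ ≤ 1 / 2 := by
    have hlim : Filter.Tendsto (fun k : ℕ => B * ‖q⁻¹ ^ k‖) Filter.atTop (nhds 0) := by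
      have h1 : Filter.Tendsto (fun k : ℕ => q⁻¹ ^ k) Filter.atTop (nhds 0) := by
        apply tendsto_pow_atTop_nhds_zero_of_norm_lt_one
        rw [norm_inv]
        exact inv_lt_one_of_one_lt₀ h.one_lt_norm_q
      simpa using h1.norm.const_mul B
    exact Filter.eventually_atTop.1 (hlim.eventually_le_const (by norm_num))
  refine ⟨10 * Λ, k₀, by linarith, fun n v l₀ l k₁ hn hv hl hk₁ => ?_⟩
  obtain ⟨u, hu0, hud, huO, hub, huO', hX, hr⟩ := h.exists_pade hS hB1 hB hv
  obtain ⟨k, hk, hkv, hne⟩ := exists_form_ne_zero (t := fun i => term s P q (α i)) h.one_le_s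
    h.natDegree_le h.eval_zero_ne h.q_ne hq1 hα0 hαq hαP
    (fun i => mul_mk_poincareCoeff h.one_le_s h.coeff_zero_ne q (α i)) (fun i => term_zero)
    (fun i k => term_succ_mul h.eval_ne k) hu0 hud hX hl k₁
  obtain ⟨w, hw0, hXO, hYO, hXb, hYb⟩ := h.approximation_bounds (Λ := Λ) hL ha hb hγ
    (by linarith) hB1 hB hc1 (by linarith) (by linarith) (by linarith)
    (fun l => by
      have h1 := norm_eval_le h.natDegree_le hC₁ (h.norm_inv_pow_le_one l)
      have h2 : ‖d * P.eval (q⁻¹ ^ l)‖ ≤ T := by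
        rw [norm_mul]
        exact mul_le_mul_of_nonneg_left h1 hd0
      linarith)
    (fun i => by
      have := Finset.single_le_sum (f := fun i => ‖d * α i‖) (fun _ _ => norm_nonneg _)
        (Finset.mem_univ i)
      linarith)
    hk₀ hn hv hud huO hub huO' hX hr (hk₁.trans hk)
  refine ⟨k, hk, hkv, _, hXO, _, hYO, fun h0 => hne ?_, hXb, hYb⟩
  apply mul_left_cancel₀ hw0
  rw [mul_zero, ← h0, mul_add, Finset.mul_sum]
  congr 1
  · ring
  · exact Finset.sum_congr rfl fun _ _ => by ring

end IntegralData

/-! ### Choice of the degree `n` and the weights `v`, and positivity of the denominator of `mu`. -/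

section Parameters

/-- The least admissible `n` is taken: failure at `n - 1` bounds `δ n²` by `h` up to linear terms,
which are absorbed in `ε` by completing a square. This is the source of `ε` in the theorem. -/
theorem exists_index {δ ν A C₁ ε : ℝ} (hδ : 0 < δ) (hν : 0 ≤ ν) (hA : 0 ≤ A) (hC : 0 ≤ C₁)
    (hε : 0 < ε) (n₀ : ℕ) : ∃ M : ℝ, ∀ h : ℝ, 0 ≤ h → ∃ n : ℕ, n₀ ≤ n ∧
      h ≤ δ * n ^ 2 - A * n ∧ ν * n ^ 2 + C₁ * n ≤ (ν / δ + ε) * h + M := by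
  set D := (ν / δ + ε) * A + 2 * ν + C₁ with hD
  have hνδ : 0 ≤ ν / δ := by positivity
  have hD0 : 0 ≤ D := by positivity
  refine ⟨ν * n₀ ^ 2 + C₁ * n₀ + ν + C₁ + D ^ 2 / (4 * (ε * δ)), fun h hh => ?_⟩
  have hex : ∃ n : ℕ, n₀ ≤ n ∧ h ≤ δ * n ^ 2 - A * n := by
    obtain ⟨n, hn⟩ := exists_nat_ge (n₀ + 1 + (A + h) / δ)
    have h1 : 0 ≤ (A + h) / δ := by positivity
    have hn1 : (1 : ℝ) ≤ n := by
      have : (0 : ℝ) ≤ n₀ := Nat.cast_nonneg _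
      linarith
    refine ⟨n, by exact_mod_cast (by linarith : (n₀ : ℝ) ≤ n), ?_⟩
    have h2 : (A + h) / δ ≤ n := by
      have : (0 : ℝ) ≤ n₀ := Nat.cast_nonneg _
      linarith
    rw [div_le_iff₀ hδ] at h2
    nlinarith
  classical
  set n := Nat.find hex with hn
  obtain ⟨hn0, hnh⟩ := Nat.find_spec hex
  refine ⟨n, hn0, hnh, ?_⟩
  have hq0 : 0 ≤ D ^ 2 / (4 * (ε * δ)) := by positivity
  rcases hn0.eq_or_lt with heq | hlt
  · have hpos : 0 ≤ (ν / δ + ε) * h := by positivity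
    rw [hn, ← heq]
    linarith
  · have hmin : ¬ (n₀ ≤ n - 1 ∧ h ≤ δ * (n - 1 : ℕ) ^ 2 - A * (n - 1 : ℕ)) :=
      Nat.find_min hex (by omega)
    obtain ⟨x, hx⟩ : ∃ x, n = x + 1 := ⟨n - 1, by omega⟩
    rw [hx, Nat.add_sub_cancel] at hmin
    have hx0 : n₀ ≤ x := by
      have : n₀ < n := hlt
      omega
    have hxh : δ * (x : ℝ) ^ 2 - A * x < h := not_le.1 fun h1 => hmin ⟨hx0, h1⟩
    have h1 : (ν / δ + ε) * (δ * (x : ℝ) ^ 2 - A * x) ≤ (ν / δ + ε) * h := by gcongr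
    have h2 : (ν / δ + ε) * (δ * (x : ℝ) ^ 2 - A * x) =
        ν * x ^ 2 + ε * δ * x ^ 2 - (ν / δ + ε) * A * x := by
      field_simp
    have h3 : D * x ≤ ε * δ * x ^ 2 + D ^ 2 / (4 * (ε * δ)) := by
      have hεδ : 0 < ε * δ := by positivity
      have h4 : ε * δ * (x - D / (2 * (ε * δ))) ^ 2 =
          ε * δ * x ^ 2 - D * x + D ^ 2 / (4 * (ε * δ)) := by
        field_simp
        ring
      have h5 : 0 ≤ ε * δ * (x - D / (2 * (ε * δ))) ^ 2 := by positivity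
      linarith
    have h6 : 0 ≤ ν * (n₀ : ℝ) ^ 2 + C₁ * n₀ := by positivity
    rw [hx]
    push_cast
    have h7 : D * x = (ν / δ + ε) * A * x + 2 * ν * x + C₁ * x := by rw [hD]; ring
    linarith

/-- Solving each inequality for `v i` and rounding up costs less than `m` in the total; the term `(m
+ 1) κ n` of the hypothesis pays for it. -/
theorem exists_weights {m : ℕ} (hm : 1 ≤ m) {κ G C₃ : ℝ} (hκ : 0 < κ) (hG : 0 ≤ G) (hC : 0 ≤ C₃)
    {h : Fin m → ℝ} (hh : ∀ i, 0 ≤ h i) {n : ℕ} (hn : 1 ≤ n)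
    (hsum : ∑ i, h i ≤ (κ / 2 - m * G) * n ^ 2 - (m * C₃ + (m + 1) * κ) * n) :
    ∃ v : Fin m → ℕ, ∑ i, v i = n / 2 ∧ ∀ i, h i + G * n ^ 2 + C₃ * n ≤ κ * n * v i := by
  have hn' : (0 : ℝ) < n := by exact_mod_cast hn
  have hκn : 0 < κ * n := by positivity
  set w : Fin m → ℝ := fun i => (h i + G * n ^ 2 + C₃ * n) / (κ * n) with hw
  have hw0 : ∀ i, 0 ≤ w i := fun i => by
    have := hh i
    positivity
  have hws : ∑ i, w i ≤ n / 2 - (m + 1) := by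
    rw [hw, ← Finset.sum_div, div_le_iff₀ hκn, Finset.sum_add_distrib, Finset.sum_add_distrib,
      Finset.sum_const, Finset.sum_const, Finset.card_univ, Fintype.card_fin, nsmul_eq_mul,
      nsmul_eq_mul]
    linarith
  have hle : ∑ i, ⌈w i⌉₊ ≤ n / 2 := by
    have h1 : (∑ i, (⌈w i⌉₊ : ℝ)) ≤ ∑ i, (w i + 1) :=
      Finset.sum_le_sum fun i _ => (Nat.ceil_lt_add_one (hw0 i)).le
    rw [Finset.sum_add_distrib, Finset.sum_const, Finset.card_univ, Fintype.card_fin,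
      nsmul_eq_mul, mul_one] at h1
    have h2 : (2 * ∑ i, (⌈w i⌉₊ : ℝ)) ≤ n := by linarith
    have h3 : 2 * ∑ i, ⌈w i⌉₊ ≤ n := by exact_mod_cast h2
    omega
  let i₀ : Fin m := ⟨0, hm⟩
  -- The unused weight goes to one index, so that the total is exactly `n / 2`: a larger total
  -- shortens the window for `k`.
  refine ⟨fun i => ⌈w i⌉₊ + Pi.single (M := fun _ => ℕ) i₀ (n / 2 - ∑ i, ⌈w i⌉₊) i, ?_, fun i => ?_⟩
  · rw [Finset.sum_add_distrib, Finset.sum_pi_single', if_pos (Finset.mem_univ _)]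
    omega
  · have h1 : w i ≤ ⌈w i⌉₊ := Nat.le_ceil _
    rw [hw, div_le_iff₀ hκn] at h1
    refine h1.trans ?_
    rw [mul_comm]
    gcongr
    push_cast
    have : (0 : ℝ) ≤ (Pi.single (M := fun _ => ℕ) i₀ (n / 2 - ∑ i, ⌈w i⌉₊) i : ℕ) :=
      Nat.cast_nonneg _
    linarith

theorem lt_rho {m s : ℕ} (hs : 1 ≤ s) {τ : ℝ} (h0 : 0 ≤ τ) (h1 : τ < 1) :
    13 * (m : ℝ) / 4 < rho m s τ := by
  have hs' : (1 : ℝ) ≤ s := by exact_mod_cast hs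
  have h2 : 0 < 1 - τ := by linarith
  have h3 : 0 ≤ τ / (2 * (1 - τ)) := by positivity
  have h4 : 0 < √((13 * (m : ℝ) / 4 + τ / (2 * (1 - τ))) ^ 2
      + (13 * m * (s + 2) + s + 17) / (4 * s) + (s + 2) * τ / (2 * s * (1 - τ))) := by
    apply Real.sqrt_pos.2
    positivity
  unfold rho
  linarith

theorem aux_denom_pos {m s : ℕ} (hs : 1 ≤ s) {τ : ℝ} (h0 : 0 ≤ τ) (h1 : τ < 1) :
    0 < 4 * s * m * rho m s τ ^ 2 + 4 * (2 * m + m * s + 1) * rho m s τ + 4 * m + m * s + 2 := by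
  have h2 := lt_rho (m := m) hs h0 h1
  have h3 : 0 < rho m s τ := lt_of_le_of_lt (by positivity) h2
  positivity

/-- The denominator in the definition of `mu` is positive below `Gamma`. -/
theorem mu_denom_pos {m s : ℕ} (hm : 1 ≤ m) (hs : 1 ≤ s) {γ : ℝ} (hγ : 0 ≤ γ)
    (hγΓ : γ < Gamma m s) : γ < 1 ∧ 0 < 4 * rho m s γ - 13 * m -
      γ * (4 * m * s * rho m s γ ^ 2 + 4 * (m * s + 2 * m + 1) * rho m s γ
        + m * s + 4 * m + 2) := by
  have hleast := isLeast_Gamma hm hs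
  have hΓ1 : Gamma m s < 1 := hleast.1.2.2
  have hs' : (1 : ℝ) ≤ s := by exact_mod_cast hs
  have hγ1 : γ < 1 := hγΓ.trans hΓ1
  refine ⟨hγ1, ?_⟩
  have hmem : ∀ x ∈ Set.Icc 0 γ, 0 < 1 - x := fun x hx => by linarith [hx.2]
  have hcr : ContinuousOn (fun τ => rho m s τ) (Set.Icc 0 γ) := by
    have hc : ContinuousOn (fun τ : ℝ => τ / (2 * (1 - τ))) (Set.Icc 0 γ) := by
      refine ContinuousOn.div (by fun_prop) (by fun_prop) fun x hx => ?_
      have := hmem x hx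
      positivity
    have hc' : ContinuousOn (fun τ : ℝ => ((s : ℝ) + 2) * τ / (2 * s * (1 - τ)))
        (Set.Icc 0 γ) := by
      refine ContinuousOn.div (by fun_prop) (by fun_prop) fun x hx => ?_
      have := hmem x hx
      positivity
    unfold rho
    fun_prop
  have hca : ContinuousOn (fun τ => aux m s τ) (Set.Icc 0 γ) := by
    unfold aux
    refine ContinuousOn.sub (ContinuousOn.div (by fun_prop) (by fun_prop) fun x hx => ?_)
      continuousOn_id
    exact (aux_denom_pos hs hx.1 (by linarith [hx.2])).ne'
  have hf0 : 0 < aux m s 0 := by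
    have h1 := lt_rho (m := m) hs le_rfl zero_lt_one
    unfold aux
    rw [sub_zero]
    exact div_pos (by linarith) (aux_denom_pos hs le_rfl zero_lt_one)
  -- Otherwise the intermediate value theorem gives a zero of `aux` in `(0, γ]`, below the least
  -- one.
  have hpos : 0 < aux m s γ := by
    by_contra! hle
    obtain ⟨x, hx, hx0⟩ := intermediate_value_Icc' hγ hca ⟨hle, hf0.le⟩
    have hx0' : aux m s x = 0 := hx0
    have hxpos : 0 < x := hx.1.lt_of_ne (by
      rintro rfl
      linarith)
    have := hleast.2 ⟨hx0', hxpos, by linarith [hx.2]⟩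
    linarith [hx.2]
  unfold aux at hpos
  rw [sub_pos, lt_div_iff₀ (aux_denom_pos hs hγ hγ1)] at hpos
  linarith

end Parameters

/-! ### Exponents in terms of `n`, and the lower bound for linear forms. -/

/-- Bound for the size of the approximations in terms of `n` alone. -/
theorem size_exponent_le {L Λ ρ C₀ : ℝ} (hL : 0 < L) (hΛ : 0 ≤ Λ) (hC : 0 ≤ C₀) (hρ : 0 ≤ ρ)
    (s : ℕ) {n k : ℕ} (hn : 1 ≤ n) (hk : (k : ℝ) ≤ (ρ + 1 / 2) * n + C₀) :
    L * (s * k ^ 2 / 2 + n * k + 13 / 8 * n ^ 2) + Λ * (k + n) ≤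
      L * ((s * (ρ + 1 / 2) ^ 2 / 2 + (ρ + 1 / 2) + 13 / 8) * n ^ 2 +
        (s * (2 * (ρ + 1 / 2) * C₀ + C₀ ^ 2) / 2 + C₀ + Λ * (ρ + 1 / 2 + C₀ + 1) / L) * n) := by
  set τ := ρ + 1 / 2 with hτ
  have hn1 : (1 : ℝ) ≤ n := by exact_mod_cast hn
  have hk0 : (0 : ℝ) ≤ k := Nat.cast_nonneg k
  have hτ0 : 0 ≤ τ := by positivity
  have hCn : C₀ ≤ C₀ * n := le_mul_of_one_le_right hC hn1
  have hC2 : C₀ ^ 2 ≤ C₀ ^ 2 * n := le_mul_of_one_le_right (by positivity) hn1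
  have hk2 : (k : ℝ) ^ 2 ≤ τ ^ 2 * n ^ 2 + (2 * τ * C₀ + C₀ ^ 2) * n := by
    calc (k : ℝ) ^ 2 ≤ (τ * n + C₀) ^ 2 := by gcongr
      _ = τ ^ 2 * n ^ 2 + 2 * τ * C₀ * n + C₀ ^ 2 := by ring
      _ ≤ _ := by linarith
  have h1 : (s : ℝ) * k ^ 2 ≤ s * (τ ^ 2 * n ^ 2 + (2 * τ * C₀ + C₀ ^ 2) * n) := by gcongr
  have h2 : (n : ℝ) * k ≤ n * (τ * n + C₀) := by gcongr
  have h3 : Λ * (k + n) ≤ Λ * ((τ + C₀ + 1) * n) := by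
    gcongr
    linarith
  have h4 : L * (s * k ^ 2 / 2 + n * k + 13 / 8 * n ^ 2) ≤
      L * (s * (τ ^ 2 * n ^ 2 + (2 * τ * C₀ + C₀ ^ 2) * n) / 2 + n * (τ * n + C₀) +
        13 / 8 * n ^ 2) := by
    gcongr
  have h5 : L * ((s * τ ^ 2 / 2 + τ + 13 / 8) * n ^ 2 +
        (s * (2 * τ * C₀ + C₀ ^ 2) / 2 + C₀ + Λ * (τ + C₀ + 1) / L) * n) =
      L * (s * (τ ^ 2 * n ^ 2 + (2 * τ * C₀ + C₀ ^ 2) * n) / 2 + n * (τ * n + C₀) +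
        13 / 8 * n ^ 2) + Λ * ((τ + C₀ + 1) * n) := by
    field_simp
    ring
  rw [h5]
  exact add_le_add h4 h3

/-- Bound for the quality of the approximations in terms of `n` and `v` alone. -/
theorem quality_exponent_le {L Λ ρ γ C₀ : ℝ} (hL : 0 < L) (hΛ : 0 ≤ Λ) (hC : 0 ≤ C₀) (hρ : 0 ≤ ρ)
    (hγ0 : 0 ≤ γ) (hγ1 : γ ≤ 1) (s : ℕ) {n k v : ℕ} (hn : 1 ≤ n) (hv : v ≤ n)
    (hk : (k : ℝ) ≤ (ρ + 1 / 2) * n + C₀) (hk' : ρ * n ≤ k) :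
    L * (γ * s * k ^ 2 / 2 + n * k + 13 / 8 * n ^ 2 - (1 - γ) * k * (n + v)) + Λ * (k + n) ≤
      L * ((13 / 8 + γ * (s * (ρ + 1 / 2) ^ 2 / 2 + (ρ + 1 / 2))) * n ^ 2 -
        (ρ - γ * (ρ + 1 / 2)) * n * v +
        (s * (2 * (ρ + 1 / 2) * C₀ + C₀ ^ 2) / 2 + 2 * C₀ + Λ * (ρ + 1 / 2 + C₀ + 1) / L) * n) := by
  set τ := ρ + 1 / 2 with hτ
  have hn1 : (1 : ℝ) ≤ n := by exact_mod_cast hn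
  have hvn : (v : ℝ) ≤ n := by exact_mod_cast hv
  have hv0 : (0 : ℝ) ≤ v := Nat.cast_nonneg v
  have hk0 : (0 : ℝ) ≤ k := Nat.cast_nonneg k
  have hτ0 : 0 ≤ τ := by positivity
  have hC2 : C₀ ^ 2 ≤ C₀ ^ 2 * n := le_mul_of_one_le_right (by positivity) hn1
  have hCn : C₀ ≤ C₀ * n := le_mul_of_one_le_right hC hn1
  have hk2 : (k : ℝ) ^ 2 ≤ τ ^ 2 * n ^ 2 + (2 * τ * C₀ + C₀ ^ 2) * n := by
    calc (k : ℝ) ^ 2 ≤ (τ * n + C₀) ^ 2 := by gcongr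
      _ = τ ^ 2 * n ^ 2 + 2 * τ * C₀ * n + C₀ ^ 2 := by ring
      _ ≤ _ := by linarith
  set D := s * (2 * τ * C₀ + C₀ ^ 2) / 2 + 2 * C₀ with hD
  have hD0 : 0 ≤ D := by positivity
  have h1 : (s : ℝ) * k ^ 2 ≤ s * (τ ^ 2 * n ^ 2 + (2 * τ * C₀ + C₀ ^ 2) * n) := by gcongr
  have h2 : (n : ℝ) * k ≤ n * (τ * n + C₀) := by gcongr
  have h2' : (v : ℝ) * k ≤ τ * n * v + C₀ * n := by
    calc (v : ℝ) * k ≤ v * (τ * n + C₀) := by gcongr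
      _ = τ * n * v + C₀ * v := by ring
      _ ≤ _ := by gcongr
  have h3 : Λ * (k + n) ≤ Λ * ((τ + C₀ + 1) * n) := by
    gcongr
    linarith
  -- Since `n k` cancels against `k n`, the exponent is `13 n²/8 + γ (s k²/2 + n k + v k) - k v`.
  -- The part with `γ` uses the upper bound for `k`, and `-k v` the lower bound.
  have h4 : γ * (s * k ^ 2 / 2 + n * k + v * k) ≤
      γ * ((s * τ ^ 2 / 2 + τ) * n ^ 2 + τ * n * v) + D * n := by
    have h5 : γ * (s * k ^ 2 / 2 + n * k + v * k) ≤
        γ * ((s * τ ^ 2 / 2 + τ) * n ^ 2 + τ * n * v + D * n) := by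
      refine mul_le_mul_of_nonneg_left ?_ hγ0
      rw [hD]
      linarith
    have h6 : γ * (D * n) ≤ D * n := mul_le_of_le_one_left (by positivity) hγ1
    linarith
  have h7 : ρ * n * v ≤ k * v := by gcongr
  have h8 : L * (γ * s * k ^ 2 / 2 + n * k + 13 / 8 * n ^ 2 - (1 - γ) * k * (n + v)) ≤
      L * ((13 / 8 + γ * (s * τ ^ 2 / 2 + τ)) * n ^ 2 - (ρ - γ * τ) * n * v + D * n) := by
    refine mul_le_mul_of_nonneg_left ?_ hL.le
    linarith
  have h9 : L * ((13 / 8 + γ * (s * τ ^ 2 / 2 + τ)) * n ^ 2 - (ρ - γ * τ) * n * v +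
        (D + Λ * (τ + C₀ + 1) / L) * n) =
      L * ((13 / 8 + γ * (s * τ ^ 2 / 2 + τ)) * n ^ 2 - (ρ - γ * τ) * n * v + D * n) +
        Λ * ((τ + C₀ + 1) * n) := by
    field_simp
    ring
  rw [h9]
  exact add_le_add h8 h3

/-- A lower bound for a linear form from one approximation. -/
theorem one_le_two_mul_norm_mul {m : ℕ} (hm : 1 ≤ m) {l₀ X : ℂ} {l φ Y : Fin m → ℂ}
    (h1 : 1 ≤ ‖l₀ * X + ∑ i, l i * Y i‖)
    (h2 : ∀ i, ‖X * φ i - Y i‖ ≤ (max 1 ‖l i‖ * (2 * m))⁻¹) :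
    1 ≤ 2 * (‖X‖ * ‖l₀ + ∑ i, l i * φ i‖) := by
  have hm' : (0 : ℝ) < m := by exact_mod_cast hm
  have h3 : X * (l₀ + ∑ i, l i * φ i) =
      (l₀ * X + ∑ i, l i * Y i) + ∑ i, l i * (X * φ i - Y i) := by
    rw [mul_add, Finset.mul_sum, add_assoc, ← Finset.sum_add_distrib]
    congr 1
    · ring
    · exact Finset.sum_congr rfl fun _ _ => by ring
  have h4 : ‖∑ i, l i * (X * φ i - Y i)‖ ≤ 1 / 2 := by
    have h5 : ∀ i ∈ (Finset.univ : Finset (Fin m)), ‖l i * (X * φ i - Y i)‖ ≤ (2 * m : ℝ)⁻¹ := by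
      intro i _
      rw [norm_mul]
      have hpos : 0 < max 1 ‖l i‖ := lt_max_of_lt_left one_pos
      calc ‖l i‖ * ‖X * φ i - Y i‖ ≤ max 1 ‖l i‖ * (max 1 ‖l i‖ * (2 * m))⁻¹ := by
            gcongr
            · exact le_max_right _ _
            · exact h2 i
        _ = (2 * m : ℝ)⁻¹ := by
            rw [mul_inv, mul_inv_cancel_left₀ hpos.ne']
    refine (norm_sum_le_of_le _ h5).trans (le_of_eq ?_)
    rw [Finset.sum_const, Finset.card_univ, Fintype.card_fin, nsmul_eq_mul]
    field_simp
  rw [← norm_mul, h3]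
  have := norm_sub_le_norm_add (l₀ * X + ∑ i, l i * Y i) (∑ i, l i * (X * φ i - Y i))
  linarith

/-- The lower estimate for linear forms over an arbitrary subring with a Siegel lemma. -/
theorem IntegralData.linear_form_estimate {O : Subring ℂ} {m s : ℕ} {P : ℂ[X]} {q a b d : ℂ}
    {α : Fin m → ℂ} (h : IntegralData O s P q a b d α) (hm : 1 ≤ m) {c : ℝ} (hc1 : 1 ≤ c)
    (hS : SiegelBound O c) (hα0 : ∀ i, α i ≠ 0)
    (hαq : ∀ i j, i ≠ j → ∀ l : ℤ, α i ≠ α j * q ^ l)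
    (hαP : P.natDegree < s ∨
      (P.natDegree = s ∧ ∀ i, ∀ n : ℕ, 1 ≤ n → α i ≠ P.leadingCoeff * q ^ n))
    {γ : ℝ} (hγ : γ = Real.log ‖b‖ / Real.log ‖a‖) (hγΓ : γ < Gamma m s) {ε : ℝ} (hε : 0 < ε) :
    ∃ C : ℝ, 0 < C ∧ ∀ (l₀ : ℂ) (l : Fin m → ℂ), l₀ ∈ O → (∀ i, l i ∈ O) →
      ¬ (l₀ = 0 ∧ ∀ i, l i = 0) →
        ‖l₀ + ∑ i, l i * phi s P q (α i)‖ > C * (∏ i, max 1 ‖l i‖) ^ (-mu m s γ - ε) := by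
  have ha1 := h.one_lt_norm_a
  have hb1 := h.one_le_norm b h.b_mem h.b_ne
  set L := Real.log ‖a‖ with hLdef
  have hL : 0 < L := Real.log_pos ha1
  have ha : ‖a‖ = Real.exp L := (Real.exp_log (by linarith)).symm
  have hb : ‖b‖ = Real.exp (γ * L) := by
    rw [hγ, div_mul_cancel₀ _ hL.ne', Real.exp_log (by linarith)]
  have hγ0 : 0 ≤ γ := by
    rw [hγ]
    exact div_nonneg (Real.log_nonneg hb1) hL.le
  obtain ⟨hγ1, hden⟩ := mu_denom_pos hm h.one_le_s hγ0 hγΓ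
  have hm' : (1 : ℝ) ≤ m := by exact_mod_cast hm
  have hρm := lt_rho (m := m) h.one_le_s hγ0 hγ1
  set ρ := rho m s γ with hρdef
  have hρ1 : 1 ≤ ρ := by linarith
  -- `κ n v_i - G n²` is the main gain in quality and `ν n²` the main size. Summing the gains with
  -- `∑ v_i ≈ n/2` leaves `δ n²`; numerator and denominator of `mu` are `8 ν` and `8 δ`.
  set G := 13 / 8 + γ * (s * (ρ + 1 / 2) ^ 2 / 2 + (ρ + 1 / 2)) with hGdef
  set κ := ρ - γ * (ρ + 1 / 2) with hκdef
  set ν := s * (ρ + 1 / 2) ^ 2 / 2 + (ρ + 1 / 2) + 13 / 8 with hνdef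
  set δ := κ / 2 - m * G with hδdef
  have hG0 : 0 ≤ G := by positivity
  have hν0 : 0 ≤ ν := by positivity
  have hδ8 : 4 * ρ - 13 * m - γ * (4 * m * s * ρ ^ 2 + 4 * (m * s + 2 * m + 1) * ρ
        + m * s + 4 * m + 2) = 8 * δ := by
    rw [hδdef, hκdef, hGdef]
    ring
  have hδ : 0 < δ := by linarith
  have hκ : 0 < κ := by
    have : 0 ≤ m * G := by positivity
    linarith
  have hmu : mu m s γ = ν / δ := by
    have hν8 : 4 * s * ρ ^ 2 + 4 * (s + 2) * ρ + (s + 17) = 8 * ν := by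
      rw [hνdef]
      ring
    rw [mu, ← hρdef, hν8, hδ8, mul_div_mul_left _ _ (by norm_num)]
  obtain ⟨Λ, k₀, hΛ, happrox⟩ := h.exists_approximations hc1 hS hα0 hαq hαP hL ha hb hγ0
  -- The extra `2` covers the rounding in `⌈ρ n⌉₊` and in `n / 2`.
  set C₀ : ℝ := ((m + 1) * (m * s) + m : ℕ) + 2 with hC₀
  have hC₀0 : 0 ≤ C₀ := by positivity
  set D₁ := s * (2 * (ρ + 1 / 2) * C₀ + C₀ ^ 2) / 2 + C₀ + Λ * (ρ + 1 / 2 + C₀ + 1) / L with hD₁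
  set D₂ := s * (2 * (ρ + 1 / 2) * C₀ + C₀ ^ 2) / 2 + 2 * C₀ + Λ * (ρ + 1 / 2 + C₀ + 1) / L
    with hD₂
  have hD₁0 : 0 ≤ D₁ := by positivity
  have hD₂0 : 0 ≤ D₂ := by positivity
  have hlog0 : 0 ≤ Real.log (2 * m) := Real.log_nonneg (by linarith)
  set C₃ := D₂ + Real.log (2 * m) / L with hC₃
  have hC₃0 : 0 ≤ C₃ := by positivity
  obtain ⟨M, hM⟩ := exists_index (A := m * C₃ + (m + 1) * κ) hδ hν0 (by positivity) hD₁0 hε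
    (k₀ + 1)
  -- The argument gives the bound with `2` in place of `4`; the larger divisor makes the inequality
  -- strict.
  refine ⟨Real.exp (-(L * M)) / 4, by positivity, fun l₀ l hl₀ hl hne => ?_⟩
  set H := ∏ i, max 1 ‖l i‖ with hH
  have hmaxpos : ∀ i, 0 < max 1 ‖l i‖ := fun i => lt_max_of_lt_left one_pos
  have hH0 : 0 < H := Finset.prod_pos fun i _ => hmaxpos i
  set η : Fin m → ℝ := fun i => Real.log (max 1 ‖l i‖) / L with hη
  have hη0 : ∀ i, 0 ≤ η i := fun i => div_nonneg (Real.log_nonneg (le_max_left _ _)) hL.le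
  have hηH : L * ∑ i, η i = Real.log H := by
    rw [hη, ← Finset.sum_div, mul_div_cancel₀ _ hL.ne', hH,
      Real.log_prod fun i _ => (hmaxpos i).ne']
  obtain ⟨n, hnk, hnh, hnM⟩ := hM (∑ i, η i) (Finset.sum_nonneg fun i _ => hη0 i)
  have hn : 1 ≤ n := by omega
  have hn1 : (1 : ℝ) ≤ n := by exact_mod_cast hn
  obtain ⟨v, hvs, hv⟩ := exists_weights hm hκ hG0 hC₃0 hη0 hn hnh
  have hρn : (n : ℝ) ≤ ρ * n := le_mul_of_one_le_left (by linarith) hρ1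
  have hk₁ : k₀ ≤ ⌈ρ * n⌉₊ := by
    have h1 : (n : ℝ) ≤ ⌈ρ * n⌉₊ := hρn.trans (Nat.le_ceil _)
    have h2 : n ≤ ⌈ρ * n⌉₊ := by exact_mod_cast h1
    omega
  obtain ⟨k, hk, hkv, X, hXO, Y, hYO, hXY, hXb, hYb⟩ :=
    happrox n v l₀ l ⌈ρ * n⌉₊ hn (by omega) hne hk₁
  have hk' : ρ * n ≤ k := (Nat.le_ceil _).trans (by exact_mod_cast hk)
  have hkub : (k : ℝ) ≤ (ρ + 1 / 2) * n + C₀ := by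
    have h1 : (⌈ρ * n⌉₊ : ℝ) < ρ * n + 1 := Nat.ceil_lt_add_one (by positivity)
    have h2 : 2 * k ≤ 2 * ⌈ρ * n⌉₊ + n + 1 + 2 * ((m + 1) * (m * s) + m) := by omega
    have h3 : (2 * k : ℝ) ≤ 2 * ⌈ρ * n⌉₊ + n + 1 + 2 * ((m + 1) * (m * s) + m : ℕ) := by
      exact_mod_cast h2
    rw [hC₀]
    linarith
  have hsize : ‖X‖ ≤ Real.exp (L * ((mu m s γ + ε) * ∑ i, η i + M)) := by
    refine hXb.trans (Real.exp_le_exp.2 ?_)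
    refine (size_exponent_le hL hΛ hC₀0 (by linarith) s hn hkub).trans ?_
    rw [hmu]
    exact mul_le_mul_of_nonneg_left hnM hL.le
  have hqual : ∀ i, ‖X * phi s P q (α i) - Y i‖ ≤ (max 1 ‖l i‖ * (2 * m))⁻¹ := by
    intro i
    have hvn : v i ≤ n := by
      have := Finset.single_le_sum (f := v) (fun _ _ => Nat.zero_le _) (Finset.mem_univ i)
      omega
    have h1 : (max 1 ‖l i‖ * (2 * m))⁻¹ = Real.exp (-(L * η i + Real.log (2 * m))) := by
      rw [Real.exp_neg, Real.exp_add, hη, mul_div_cancel₀ _ hL.ne', Real.exp_log (hmaxpos i),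
        Real.exp_log (by linarith)]
    rw [h1]
    refine (hYb i).trans (Real.exp_le_exp.2 ?_)
    refine (quality_exponent_le hL hΛ hC₀0 (by linarith) hγ0 hγ1.le s hn hvn hkub hk').trans ?_
    have h2 := hv i
    have h3 : L * (η i + G * n ^ 2 + C₃ * n) ≤ L * (κ * n * v i) :=
      mul_le_mul_of_nonneg_left h2 hL.le
    have h4 : L * (C₃ * n) = L * (D₂ * n) + Real.log (2 * m) * n := by
      rw [hC₃]
      field_simp
    have h5 : Real.log (2 * m) ≤ Real.log (2 * m) * n := le_mul_of_one_le_right hlog0 hn1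
    rw [← hGdef, ← hκdef, ← hD₂]
    linarith
  have hXY1 : 1 ≤ ‖l₀ * X + ∑ i, l i * Y i‖ :=
    h.one_le_norm _ (add_mem (mul_mem hl₀ hXO) (sum_mem fun i _ => mul_mem (hl i) (hYO i))) hXY
  have hfin := one_le_two_mul_norm_mul hm hXY1 hqual
  set F := ‖l₀ + ∑ i, l i * phi s P q (α i)‖ with hF
  have hHpow : H ^ (-mu m s γ - ε) = Real.exp (-((mu m s γ + ε) * (L * ∑ i, η i))) := by
    rw [Real.rpow_def_of_pos hH0, hηH]
    ring_nf
  have hF1 : 1 ≤ 2 * (Real.exp (L * ((mu m s γ + ε) * ∑ i, η i + M)) * F) := by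
    refine hfin.trans ?_
    gcongr
  set E := Real.exp (L * ((mu m s γ + ε) * ∑ i, η i + M)) with hE
  have hE0 : 0 < E := Real.exp_pos _
  have hprod : Real.exp (-(L * M)) * H ^ (-mu m s γ - ε) = E⁻¹ := by
    rw [hHpow, ← Real.exp_add, hE, ← Real.exp_neg]
    ring_nf
  have hCE : Real.exp (-(L * M)) / 4 * H ^ (-mu m s γ - ε) = E⁻¹ / 4 := by
    rw [← hprod]
    ring
  rw [gt_iff_lt, hCE]
  have hinv : 0 < E⁻¹ := inv_pos.2 hE0
  have h6 : E⁻¹ ≤ 2 * F := by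
    rw [inv_le_iff_one_le_mul₀ hE0]
    linarith
  linarith

end Heine

theorem theorem1 (K : Type*) [Field K] [NumberField K] (hK : Heine.IsRatOrImagQuadratic K)
    (σ : K →+* ℂ) (m s : ℕ) (hm : 1 ≤ m) (hs : 1 ≤ s)
    (a b : NumberField.RingOfIntegers K) (q : K) (hqab : q = (a : K) / (b : K))
    (hq : 1 < ‖σ q‖)
    (P : Polynomial K) (hPdeg : P.natDegree ≤ s) (hP0 : P.eval 0 ≠ 0)
    (hPq : ∀ k : ℕ, P.eval ((q ^ k)⁻¹) ≠ 0)
    (α : Fin m → K) (hα0 : ∀ i, α i ≠ 0)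
    (hαq : ∀ i j, i ≠ j → ∀ l : ℤ, α i ≠ α j * q ^ l)
    (hαP : P.natDegree < s ∨
      (P.natDegree = s ∧ ∀ i, ∀ n : ℕ, 1 ≤ n → α i ≠ P.leadingCoeff * q ^ n))
    (γ : ℝ) (hγ : γ = Real.log ‖σ (b : K)‖ / Real.log ‖σ (a : K)‖)
    (hγΓ : γ < Heine.Gamma m s) :
    ∀ ε : ℝ, 0 < ε → ∃ C : ℝ, 0 < C ∧
      ∀ (l₀ : NumberField.RingOfIntegers K) (l : Fin m → NumberField.RingOfIntegers K),
        ¬ (l₀ = 0 ∧ ∀ i, l i = 0) →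
        ‖σ (l₀ : K) + ∑ i, σ (l i : K) * Heine.phi s (P.map σ) (σ q) (σ (α i))‖ >
          C * (∏ i, max 1 ‖σ (l i : K)‖) ^ (-Heine.mu m s γ - ε) := by
  have hσ := σ.injective
  -- One `d` for the finite family of all `P_j`, `P_j / P_0`, `α_i`, `α_i / P_0`; indices `j > s`
  -- give zero coefficients.
  obtain ⟨d, hdO, hd0, hd⟩ := Heine.exists_denominator σ
    (Sum.elim (fun j : Fin (s + 1) => P.coeff j) (Sum.elim
      (fun j : Fin (s + 1) => P.coeff j / P.coeff 0)
      (Sum.elim α fun i => α i / P.coeff 0)))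
  have hσq : σ q = σ (a : K) / σ (b : K) := by rw [hqab, map_div₀]
  have heval : ∀ x : K, (P.map σ).eval (σ x) = σ (P.eval x) := fun x => eval_map_apply σ x
  have hdeg : (P.map σ).natDegree = P.natDegree := natDegree_map σ
  have hlead : (P.map σ).leadingCoeff = σ P.leadingCoeff := leadingCoeff_map σ
  have hcoeff : ∀ j, s < j → P.coeff j = 0 := fun j hj =>
    coeff_eq_zero_of_natDegree_lt (lt_of_le_of_lt hPdeg hj)
  have data : Heine.IntegralData (Heine.intRange σ) s (P.map σ) (σ q) (σ (a : K)) (σ (b : K)) d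
      (fun i => σ (α i)) :=
    { one_le_norm := fun x hx hx0 => Heine.one_le_norm_of_mem_intRange hK σ hx hx0
      one_le_s := hs
      a_mem := Heine.mem_intRange σ a
      b_mem := Heine.mem_intRange σ b
      d_mem := hdO
      d_ne := hd0
      q_eq := hσq
      one_lt_norm_q := hq
      natDegree_le := hdeg.trans_le hPdeg
      eval_zero_ne := by
        have := heval 0
        rw [map_zero] at this
        rw [this]
        exact (_root_.map_ne_zero σ).2 hP0
      eval_ne := fun k => by
        rw [← map_inv₀, ← map_pow, heval, inv_pow]
        exact (_root_.map_ne_zero σ).2 (hPq k)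
      d_mul_coeff := fun j => by
        rw [coeff_map]
        rcases lt_or_ge s j with hj | hj
        · rw [hcoeff j hj, map_zero, mul_zero]
          exact zero_mem _
        · exact hd (Sum.inl ⟨j, Nat.lt_succ_of_le hj⟩)
      d_mul_coeff_div := fun j => by
        rw [coeff_map, coeff_map, ← map_div₀]
        rcases lt_or_ge s j with hj | hj
        · rw [hcoeff j hj, zero_div, map_zero, mul_zero]
          exact zero_mem _
        · exact hd (Sum.inr (Sum.inl ⟨j, Nat.lt_succ_of_le hj⟩))
      d_mul_α := fun i => hd (Sum.inr (Sum.inr (Sum.inl i)))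
      d_mul_α_div := fun i => by
        rw [coeff_map, ← map_div₀]
        exact hd (Sum.inr (Sum.inr (Sum.inr i))) }
  obtain ⟨c, hc1, hS⟩ := Heine.exists_siegelBound hK σ
  intro ε hε
  obtain ⟨C, hC, hmain⟩ := data.linear_form_estimate hm hc1 hS
    (fun i => (_root_.map_ne_zero σ).2 (hα0 i))
    (fun i j hij l h0 => hαq i j hij l (hσ (by rw [h0, map_mul, map_zpow₀])))
    (by
      rw [hdeg, hlead]
      refine hαP.imp id fun h => ⟨h.1, fun i n hn h0 => h.2 i n hn (hσ ?_)⟩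
      rw [h0, map_mul, map_pow])
    hγ hγΓ hε
  refine ⟨C, hC, fun l₀ l hl => hmain (σ (l₀ : K)) (fun i => σ (l i : K))
    (Heine.mem_intRange σ l₀) (fun i => Heine.mem_intRange σ (l i)) fun h0 => hl ?_⟩
  simpa only [map_eq_zero, NumberField.RingOfIntegers.coe_eq_zero_iff] using h0
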